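/- A \emph{generator} is a convex, strictly decreasing function $\varphi:[0,1]\to[0,\infty]$ with $\varphi(1)=0$; all generators are assumed to be right-continuous at $0$ and normalized by $\varphi(\tfrac12)=1$. The Archimedean copula induced by $\varphi$ is $C(x,y)=\varphi^{-}(\varphi(x)+\varphi(y))$, $x,y\in[0,1]$, where $\varphi^{-}(s)=\varphi^{-1}(s)$ for $s\in[0,\varphi(0+))$ and $\varphi^{-}(s)=0$ for $s\ge\varphi(0+)$. Its Kendall distribution function is $F^{\mathrm{Kendall}}(t)=\mathbb{P}(C(X,Y)\le t)$, where $(X,Y)$ is a random vector with distribution function $C$. Let $D^+\varphi$ denote the right-hand derivative of $\varphi$ on $(0,1)$ and $\mathrm{Cont}(D^+\varphi)\subseteq(0,1)$ the set of its continuity points in $(0,1)$. \textbf{Theorem.} Let $C,C_1,C_2,\ldots$ be Archimedean copulas with generators $\varphi,\varphi_1,\varphi_2,\ldots$ (normalized and right-continuous at $0$) and Kendall distribution functions $F^{\mathrm{Kendall}},F_1^{\mathrm{Kendall}},F_2^{\mathrm{Kendall}},\ldots$, respectively. Then the following conditions are equivalent: (a) $\lim_{n\to\infty}C_n(x,y)=C(x,y)$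 for all $x,y\in[0,1]$; (b) $\lim_{n\to\infty}F_n^{\mathrm{Kendall}}(x)=F^{\mathrm{Kendall}}(x)$ for all $x\in\mathrm{Cont}(D^+\varphi)$; (c) $\lim_{n\to\infty}\varphi_n(x)=\varphi(x)$ for all $x\in(0,1]$; (d) $\lim_{n\to\infty}D^+\varphi_n(x)=D^+\varphi(x)$ for all $x\in\mathrm{Cont}(D^+\varphi)$. Moreover, these conditions do not imply convergence of the generators at $0$: there are such $C,C_1,C_2,\ldots$ with $C_n\to C$ pointwise on $[0,1]^2$ for which $\varphi_n(0)$ does not converge to $\varphi(0)$. -/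

import Mathlib

open Set Filter Topology MeasureTheory
open scoped ENNReal NNReal

noncomputable section

/-- A generator of a bivariate Archimedean copula: a convex, strictly decreasing function
`φ : [0,1] → [0,∞]` with `φ 1 = 0`.  Only the values of `φ` on `[0,1]` matter. -/
structure IsGenerator (φ : ℝ → ℝ≥0∞) : Prop where
  convexOn : ConvexOn ℝ≥0 (Icc (0 : ℝ) 1) φ
  strictAntiOn : StrictAntiOn φ (Icc (0 : ℝ) 1)
  map_one : φ 1 = 0

/-- A generator that is right-continuous at `0` and normalized by `φ (1/2) = 1`. -/
structure IsNormalizedGenerator (φ : ℝ → ℝ≥0∞) : Prop extends IsGenerator φ where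
  rightContinuous_zero : ContinuousWithinAt φ (Ici 0) 0
  map_half : φ (1 / 2) = 1

/-- The pseudoinverse `φ⁻ : [0,∞] → [0,1]`: the inverse of `φ` on `[0, φ(0+))`,
and `0` on `[φ(0+), ∞]`. -/
def pseudoInverse (φ : ℝ → ℝ≥0∞) (s : ℝ≥0∞) : ℝ :=
  open scoped Classical in
  if s < Function.rightLim φ 0 then Function.invFunOn φ (Icc (0 : ℝ) 1) s else 0

/-- The Archimedean copula `C(x,y) = φ⁻(φ(x) + φ(y))` induced by `φ`
(meaningful for `x, y ∈ [0,1]`). -/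
def archimedeanCopula (φ : ℝ → ℝ≥0∞) (x y : ℝ) : ℝ :=
  pseudoInverse φ (φ x + φ y)

/-- `μ` is the probability measure of the copula `C`, i.e. the law on `[0,1]²` of a pair
`(X,Y)` with distribution function `C`. -/
def IsCopulaMeasure (C : ℝ → ℝ → ℝ) (μ : Measure (ℝ × ℝ)) : Prop :=
  IsProbabilityMeasure μ ∧
    ∀ x ∈ Icc (0 : ℝ) 1, ∀ y ∈ Icc (0 : ℝ) 1, μ.real (Icc 0 x ×ˢ Icc 0 y) = C x y

/-- The probability measure `μ_C` of the copula `C` (it is unique; the value `0` is a default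
for functions `C` that are not copulas). -/
def copulaMeasure (C : ℝ → ℝ → ℝ) : Measure (ℝ × ℝ) :=
  open scoped Classical in
  if h : ∃ μ, IsCopulaMeasure C μ then h.choose else 0

/-- The Kendall distribution function of a copula `C`: the distribution function
`t ↦ P(C(X,Y) ≤ t)` of `C(X,Y)`, where `(X,Y)` has distribution function `C`. -/
def kendallDistribution (C : ℝ → ℝ → ℝ) (t : ℝ) : ℝ :=
  (copulaMeasure C).real {p | p ∈ Icc (0 : ℝ) 1 ×ˢ Icc (0 : ℝ) 1 ∧ C p.1 p.2 ≤ t}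

/-- The right-hand derivative `D⁺φ(x)`, for `x ∈ (0,1)` (a generator is finite on `(0,1]`). -/
def rightDerivative (φ : ℝ → ℝ≥0∞) (x : ℝ) : ℝ :=
  derivWithin (fun t => (φ t).toReal) (Ioi x) x

/-- `Cont(D⁺φ)`: the continuity points of `D⁺φ` in `(0,1)`. -/
def contPoints (φ : ℝ → ℝ≥0∞) : Set ℝ :=
  {x | x ∈ Ioo (0 : ℝ) 1 ∧ ContinuousAt (rightDerivative φ) x}

end

/-! Everything passes through pointwise convergence of the generators on `(0,1]`.

The Kendall distribution function on `(0,1)` is `F(t) = t - φ(t) / D⁺φ(t)`, the root of the right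
tangent at `t` (`kendallDistribution_eq`). To see this, let `W` have this `F` as distribution
function and let `U` be an independent uniform variable. The pair `(φ⁻(Uφ(W)), φ⁻((1-U)φ(W)))` has
the copula as joint distribution function, because `E[(1 - s/φ(W))⁺] = φ⁻(s)`
(`lintegral_kendallMeasure`), and the copula evaluated at the pair is `W`.

Generators and derivatives: convexity traps `D⁺φₙ(x)` between slopes of chords, and conversely `φ(x)
= -∫ D⁺φ` over `[x,1]` with dominated convergence.

Kendall functions to generators: `1/(F(v) - v) = -D⁺φ(v)/φ(v)` is the right derivative of `-log φ`,
so with `φ(1/2) = 1` the generator is the exponential of minus the integral of `1/(F(v) - v)` from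
`1/2` to `x`. Domination needs `Fₙ(v) - v` bounded below on compacts
(`exists_forall_le_tangentRoot_sub`).

Copulas to generators: the copula compares `φ(x) + φ(y)` with `φ(z)`. Starting from the common level
`1`, halving and adding show that every positive dyadic level below `φ 0` is asymptotically
respected by the `φₙ` (`SeparatesLevel`); such levels are dense.

Convergence at `0` can fail: a vanishing multiple of `1/x - 1` added to a bounded generator is
invisible on `(0,1]` but infinite at `0`. -/

namespace IsGenerator

/-! ### Convexity, slopes and one-sided derivatives of generators. -/

variable {φ : ℝ → ℝ≥0∞}

theorem ne_top (h : IsGenerator φ) {x : ℝ} (hx : x ∈ Ioc (0 : ℝ) 1) : φ x ≠ ⊤ :=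
  ((h.strictAntiOn (by simp) ⟨hx.1.le, hx.2⟩ hx.1).trans_le le_top).ne

theorem ofReal_toReal (h : IsGenerator φ) {x : ℝ} (hx : x ∈ Ioc (0 : ℝ) 1) :
    ENNReal.ofReal (φ x).toReal = φ x :=
  ENNReal.ofReal_toReal (h.ne_top hx)

theorem strictAntiOn_toReal (h : IsGenerator φ) :
    StrictAntiOn (fun x => (φ x).toReal) (Ioc (0 : ℝ) 1) := fun _ hx _ hy hxy =>
  (ENNReal.toReal_lt_toReal (h.ne_top hy) (h.ne_top hx)).2
    (h.strictAntiOn (Ioc_subset_Icc_self hx) (Ioc_subset_Icc_self hy) hxy)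

theorem convexOn_toReal (h : IsGenerator φ) :
    ConvexOn ℝ (Ioc (0 : ℝ) 1) (fun x => (φ x).toReal) := by
  refine ⟨convex_Ioc 0 1, fun x hx y hy a b ha hb hab => ?_⟩
  lift a to ℝ≥0 using ha
  lift b to ℝ≥0 using hb
  have h1 := h.convexOn.2 (Ioc_subset_Icc_self hx) (Ioc_subset_Icc_self hy) zero_le
    zero_le (by exact_mod_cast hab)
  have h2 := ENNReal.toReal_mono (b := a • φ x + b • φ y)
    (by
      simp only [ENNReal.smul_def, smul_eq_mul]
      exact ENNReal.add_ne_top.2 ⟨ENNReal.mul_ne_top (by simp) (h.ne_top hx),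
        ENNReal.mul_ne_top (by simp) (h.ne_top hy)⟩) h1
  rw [ENNReal.toReal_add] at h2
  · simpa [ENNReal.smul_def, NNReal.smul_def] using h2
  · exact ENNReal.mul_ne_top (by simp) (h.ne_top hx)
  · exact ENNReal.mul_ne_top (by simp) (h.ne_top hy)

theorem toReal_one (h : IsGenerator φ) : (φ 1).toReal = 0 := by simp [h.map_one]

theorem toReal_pos (h : IsGenerator φ) {x : ℝ} (hx : x ∈ Ioo (0 : ℝ) 1) : 0 < (φ x).toReal := by
  have := h.strictAntiOn_toReal (Ioo_subset_Ioc_self hx) (by simp : (1 : ℝ) ∈ Ioc (0 : ℝ) 1) hx.2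
  simpa [h.map_one] using this

theorem pos (h : IsGenerator φ) {x : ℝ} (hx : x ∈ Ico (0 : ℝ) 1) : 0 < φ x := by
  have := h.strictAntiOn (Ico_subset_Icc_self hx) (by simp : (1 : ℝ) ∈ Icc (0 : ℝ) 1) hx.2
  simpa [h.map_one] using this

theorem hasDerivWithinAt (h : IsGenerator φ) {x : ℝ} (hx : x ∈ Ioo (0 : ℝ) 1) :
    HasDerivWithinAt (fun t => (φ t).toReal) (rightDerivative φ x) (Ioi x) x :=
  h.convexOn_toReal.hasDerivWithinAt_rightDeriv_of_mem_interior (by simpa [interior_Ioc] using hx)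

theorem rightDerivative_le_slope (h : IsGenerator φ) {x y : ℝ} (hx : 0 < x) (hxy : x < y)
    (hy : y ≤ 1) : rightDerivative φ x ≤ ((φ y).toReal - (φ x).toReal) / (y - x) := by
  rw [← slope_def_field (fun t => (φ t).toReal)]
  exact h.convexOn_toReal.rightDeriv_le_slope_of_mem_interior
    (by rw [interior_Ioc]; exact ⟨hx, hxy.trans_le hy⟩) ⟨hx.trans hxy, hy⟩ hxy

theorem slope_le_rightDerivative (h : IsGenerator φ) {x y : ℝ} (hx : 0 < x) (hxy : x < y)
    (hy : y < 1) : ((φ y).toReal - (φ x).toReal) / (y - x) ≤ rightDerivative φ y := by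
  rw [← slope_def_field (fun t => (φ t).toReal)]
  have hy' : y ∈ interior (Ioc (0 : ℝ) 1) := by rw [interior_Ioc]; exact ⟨hx.trans hxy, hy⟩
  exact (h.convexOn_toReal.slope_le_leftDeriv_of_mem_interior ⟨hx, hxy.le.trans hy.le⟩
    hy' hxy).trans (h.convexOn_toReal.leftDeriv_le_rightDeriv_of_mem_interior hy')

theorem monotoneOn_rightDerivative (h : IsGenerator φ) :
    MonotoneOn (rightDerivative φ) (Ioo (0 : ℝ) 1) := by
  have := h.convexOn_toReal.monotoneOn_rightDeriv
  rwa [interior_Ioc] at this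

theorem rightDerivative_neg (h : IsGenerator φ) {x : ℝ} (hx : x ∈ Ioo (0 : ℝ) 1) :
    rightDerivative φ x < 0 := by
  refine (h.rightDerivative_le_slope hx.1 hx.2 le_rfl).trans_lt ?_
  rw [h.toReal_one]
  exact div_neg_of_neg_of_pos (by linarith [h.toReal_pos hx]) (by linarith [hx.2])

theorem continuousOn_toReal (h : IsGenerator φ) :
    ContinuousOn (fun x => (φ x).toReal) (Ioc (0 : ℝ) 1) := by
  intro x hx
  rcases hx.2.lt_or_eq with hx1 | rfl
  · have := h.convexOn_toReal.continuousOn_interior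
    rw [interior_Ioc] at this
    exact (this.continuousAt (Ioo_mem_nhds hx.1 hx1)).continuousWithinAt
  -- The endpoint `1` is not interior, so convexity alone does not give continuity there; `φ` is
  -- squeezed between `0` and its chord over `[1/2, 1]`.
  · have hlim : Tendsto (fun x : ℝ => (φ (1/2)).toReal * (2 * (1 - x))) (𝓝[Ioc 0 1] 1) (𝓝 0) := by
      have : Continuous fun x : ℝ => (φ (1/2)).toReal * (2 * (1 - x)) := by fun_prop
      simpa using (this.tendsto 1).mono_left nhdsWithin_le_nhds
    rw [ContinuousWithinAt, h.toReal_one]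
    refine tendsto_of_tendsto_of_tendsto_of_le_of_le' tendsto_const_nhds hlim
      (Eventually.of_forall fun x => ENNReal.toReal_nonneg) ?_
    have : Ioi (1/2 : ℝ) ∈ 𝓝[Ioc 0 1] (1 : ℝ) :=
      mem_nhdsWithin_of_mem_nhds (Ioi_mem_nhds (by norm_num))
    filter_upwards [this, self_mem_nhdsWithin] with y hy hy1
    have hy : (1/2 : ℝ) < y := hy
    have := h.convexOn_toReal.2 (by norm_num : (1 / 2 : ℝ) ∈ Ioc (0 : ℝ) 1)
      (by norm_num : (1 : ℝ) ∈ Ioc (0 : ℝ) 1) (by linarith [hy1.2] : 0 ≤ 2 * (1 - y))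
      (by linarith : 0 ≤ 2 * y - 1) (by ring)
    simp only [smul_eq_mul, h.toReal_one] at this
    have e : 2 * (1 - y) * (1 / 2) + (2 * y - 1) * 1 = y := by ring
    rw [e] at this
    linarith

/-- Monotonicity bounds values to the right from below. From above, `D⁺φ(y)` is at most the slope
from `y` to a fixed `z`, which tends to the slope from `x` to `z`, itself close to `D⁺φ(x)` for
suitable `z`. -/
theorem continuousWithinAt_rightDerivative (h : IsGenerator φ) {x : ℝ} (hx : x ∈ Ioo (0 : ℝ) 1) :
    ContinuousWithinAt (rightDerivative φ) (Ioi x) x := by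
  have hmem : Ioo x 1 ∈ 𝓝[>] x := Ioo_mem_nhdsGT hx.2
  refine tendsto_order.2 ⟨fun a ha => ?_, fun a ha => ?_⟩
  · filter_upwards [hmem] with y hy
    exact ha.trans_le (h.monotoneOn_rightDerivative hx ⟨hx.1.trans hy.1, hy.2⟩ hy.1.le)
  · have h1 := (hasDerivWithinAt_iff_tendsto_slope' (by simp)).1 (h.hasDerivWithinAt hx)
    obtain ⟨z, hz, hza⟩ := ((h1.eventually (gt_mem_nhds ha)).and hmem).exists
    rw [slope_def_field] at hz
    have hc : Tendsto (fun y => ((φ z).toReal - (φ y).toReal) / (z - y)) (𝓝[>] x)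
        (𝓝 (((φ z).toReal - (φ x).toReal) / (z - x))) := by
      have hf : ContinuousAt (fun t => (φ t).toReal) x :=
        h.continuousOn_toReal.continuousAt (Ioc_mem_nhds hx.1 hx.2)
      refine Tendsto.div (tendsto_const_nhds.sub (hf.tendsto.mono_left nhdsWithin_le_nhds))
        (tendsto_const_nhds.sub (tendsto_id.mono_left nhdsWithin_le_nhds)) ?_
      linarith [hza.1]
    filter_upwards [hc.eventually (gt_mem_nhds hz), Ioo_mem_nhdsGT hza.1] with y hy hyz
    exact (h.rightDerivative_le_slope (hx.1.trans hyz.1) hyz.2 hza.2.le).trans_lt hy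

end IsGenerator

/-! ### The pseudoinverse as an order-theoretic adjoint of the generator. -/

namespace IsNormalizedGenerator

variable {φ : ℝ → ℝ≥0∞}

theorem toReal_half (h : IsNormalizedGenerator φ) : (φ (1 / 2)).toReal = 1 := by
  rw [h.map_half, ENNReal.toReal_one]

theorem continuousOn (h : IsNormalizedGenerator φ) : ContinuousOn φ (Icc (0 : ℝ) 1) := by
  intro x hx
  rcases hx.1.eq_or_lt with rfl | hx0
  · exact h.rightContinuous_zero.mono Icc_subset_Ici_self
  · have h1 : ContinuousWithinAt φ (Ioc 0 1) x := by
      have := ENNReal.continuous_ofReal.continuousAt.comp_continuousWithinAt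
        (h.continuousOn_toReal x ⟨hx0, hx.2⟩)
      exact this.congr (fun y hy => (h.ofReal_toReal hy).symm) (h.ofReal_toReal ⟨hx0, hx.2⟩).symm
    refine h1.mono_of_mem_nhdsWithin ?_
    rw [← Ioi_inter_Iic, ← Ici_inter_Iic]
    exact inter_mem (mem_nhdsWithin_of_mem_nhds (Ioi_mem_nhds hx0))
      (mem_of_superset self_mem_nhdsWithin inter_subset_right)

theorem rightLim_zero (h : IsNormalizedGenerator φ) : Function.rightLim φ 0 = φ 0 :=
  h.rightContinuous_zero.rightLim_eq

theorem exists_eq (h : IsNormalizedGenerator φ) {s : ℝ≥0∞} (hs : s ≤ φ 0) :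
    ∃ x ∈ Icc (0 : ℝ) 1, φ x = s := by
  have := intermediate_value_Icc' zero_le_one h.continuousOn
  rw [h.map_one] at this
  exact this ⟨zero_le, hs⟩

theorem pseudoInverse_mem (h : IsNormalizedGenerator φ) (s : ℝ≥0∞) :
    pseudoInverse φ s ∈ Icc (0 : ℝ) 1 := by
  unfold pseudoInverse
  split_ifs with hs
  · rw [h.rightLim_zero] at hs
    exact Function.invFunOn_mem (h.exists_eq hs.le)
  · simp

theorem map_pseudoInverse (h : IsNormalizedGenerator φ) (s : ℝ≥0∞) :
    φ (pseudoInverse φ s) = min s (φ 0) := by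
  unfold pseudoInverse
  rw [h.rightLim_zero]
  split_ifs with hs
  · rw [Function.invFunOn_eq (h.exists_eq hs.le), min_eq_left hs.le]
  · rw [min_eq_right (not_lt.1 hs)]

theorem pseudoInverse_le_iff (h : IsNormalizedGenerator φ) {s : ℝ≥0∞} {x : ℝ}
    (hx : x ∈ Icc (0 : ℝ) 1) : pseudoInverse φ s ≤ x ↔ φ x ≤ s := by
  rw [← h.strictAntiOn.le_iff_ge hx (h.pseudoInverse_mem s), h.map_pseudoInverse, le_min_iff]
  exact and_iff_left (h.strictAntiOn.antitoneOn (by simp) hx hx.1)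

theorem lt_pseudoInverse_iff (h : IsNormalizedGenerator φ) {s : ℝ≥0∞} {x : ℝ}
    (hx : x ∈ Icc (0 : ℝ) 1) : x < pseudoInverse φ s ↔ s < φ x := by
  rw [← not_le, h.pseudoInverse_le_iff hx, not_le]

/-- The point `0` must be excluded: `φ 0 < s` is possible there, while the pseudoinverse is never
negative. -/
theorem pseudoInverse_lt_iff (h : IsNormalizedGenerator φ) {s : ℝ≥0∞} {x : ℝ}
    (hx : x ∈ Ioc (0 : ℝ) 1) : pseudoInverse φ s < x ↔ φ x < s := by
  have hx' := Ioc_subset_Icc_self hx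
  rw [← h.strictAntiOn.lt_iff_gt hx' (h.pseudoInverse_mem s), h.map_pseudoInverse, lt_min_iff]
  exact and_iff_left (h.strictAntiOn (by simp) hx' hx.1)

theorem pseudoInverse_map (h : IsNormalizedGenerator φ) {x : ℝ}
    (hx : x ∈ Icc (0 : ℝ) 1) : pseudoInverse φ (φ x) = x := by
  refine h.strictAntiOn.injOn (h.pseudoInverse_mem _) hx ?_
  rw [h.map_pseudoInverse, min_eq_left]
  exact h.strictAntiOn.antitoneOn (by simp) hx hx.1

theorem antitone_pseudoInverse (h : IsNormalizedGenerator φ) : Antitone (pseudoInverse φ) := by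
  intro s t hst
  rw [h.pseudoInverse_le_iff (h.pseudoInverse_mem _), h.map_pseudoInverse]
  exact (min_le_left _ _).trans hst

end IsNormalizedGenerator

/-! ### Integration of right derivatives and uniqueness of the copula measure. -/

theorem lintegral_ofReal_eq_sub_of_hasDerivWithinAt_Ioi {p G : ℝ → ℝ} {a b : ℝ} (hab : a ≤ b)
    (hp : ContinuousOn p (Icc a b)) (hd : ∀ x ∈ Ioo a b, HasDerivWithinAt p (G x) (Ioi x) x)
    (hG : ∀ x ∈ Ioo a b, 0 ≤ G x) :
    ∫⁻ x in Ioo a b, ENNReal.ofReal (G x) = ENNReal.ofReal (p b - p a) := by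
  have hint : IntegrableOn G (Ioc a b) :=
    intervalIntegral.integrableOn_deriv_right_of_nonneg hp hd hG
  have hftc : ∫ x in a..b, G x = p b - p a := by
    refine intervalIntegral.integral_eq_sub_of_hasDeriv_right (by rwa [uIcc_of_le hab]) ?_ ?_
    · rwa [min_eq_left hab, max_eq_right hab]
    · rwa [intervalIntegrable_iff_integrableOn_Ioc_of_le hab]
  rw [← hftc, intervalIntegral.integral_of_le hab, integral_Ioc_eq_integral_Ioo,
    ofReal_integral_eq_lintegral_ofReal (hint.mono_set Ioo_subset_Ioc_self)]
  exact (ae_restrict_iff' measurableSet_Ioo).2 (Eventually.of_forall hG)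

theorem generateFrom_Iic_prod_Iic :
    MeasurableSpace.generateFrom (image2 (· ×ˢ ·) (range (Iic : ℝ → Set ℝ)) (range Iic)) =
      (inferInstance : MeasurableSpace (ℝ × ℝ)) := by
  have hs : IsCountablySpanning (range (Iic : ℝ → Set ℝ)) :=
    ⟨fun n : ℕ => Iic (n : ℝ), fun n => mem_range_self _, iUnion_eq_univ_iff.2 exists_nat_ge⟩
  have hg : MeasurableSpace.generateFrom (range (Iic : ℝ → Set ℝ)) =
      (inferInstance : MeasurableSpace ℝ) := by
    rw [← borel_eq_generateFrom_Iic]; exact BorelSpace.measurable_eq.symm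
  exact generateFrom_eq_prod hg hg hs hs

theorem isPiSystem_Iic_prod_Iic :
    IsPiSystem (image2 (· ×ˢ ·) (range (Iic : ℝ → Set ℝ)) (range (Iic : ℝ → Set ℝ))) := by
  have : IsPiSystem (range (Iic : ℝ → Set ℝ)) := isPiSystem_Iic
  exact this.prod this

namespace IsCopulaMeasure

variable {C : ℝ → ℝ → ℝ} {μ ν : Measure (ℝ × ℝ)}

/-- Since `C 1 1 = 1`, all mass lies in the unit square, so the values of `C` there determine the
measure of every quadrant. -/
theorem measure_Iic_prod_Iic (h : IsCopulaMeasure C μ) (hC : C 1 1 = 1) (a b : ℝ) :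
    μ (Iic a ×ˢ Iic b) =
      if 0 ≤ a ∧ 0 ≤ b then ENNReal.ofReal (C (min a 1) (min b 1)) else 0 := by
  have := h.1
  have hsq : μ (Icc 0 1 ×ˢ Icc 0 1)ᶜ = 0 := by
    rw [prob_compl_eq_zero_iff (measurableSet_Icc.prod measurableSet_Icc)]
    have := h.2 1 (by simp) 1 (by simp)
    rwa [hC, measureReal_def, ENNReal.toReal_eq_one_iff] at this
  rw [← measure_inter_add_sdiff (Iic a ×ˢ Iic b)
    ((measurableSet_Icc (a := (0 : ℝ)) (b := 1)).prod (measurableSet_Icc (a := (0 : ℝ)) (b := 1))),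
    measure_mono_null (sdiff_subset_compl _ _) hsq, add_zero, prod_inter_prod]
  split_ifs with hab
  · have e : ∀ c : ℝ, Iic c ∩ Icc 0 1 = Icc 0 (min c 1) := fun c => by
      ext t; simp only [mem_inter_iff, mem_Iic, mem_Icc, le_min_iff]; tauto
    rw [e, e, ← h.2 _ ⟨le_min hab.1 zero_le_one, min_le_right _ _⟩ _
      ⟨le_min hab.2 zero_le_one, min_le_right _ _⟩, ofReal_measureReal]
  · convert measure_empty (μ := μ)
    rw [prod_eq_empty_iff]
    by_contra! hne
    obtain ⟨⟨s, hs⟩, ⟨t, ht⟩⟩ := hne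
    exact hab ⟨hs.2.1.trans hs.1, ht.2.1.trans ht.1⟩

theorem unique (hμ : IsCopulaMeasure C μ) (hν : IsCopulaMeasure C ν) (hC : C 1 1 = 1) :
    μ = ν := by
  have := hμ.1
  have := hν.1
  refine ext_of_generate_finite _ generateFrom_Iic_prod_Iic.symm isPiSystem_Iic_prod_Iic ?_ (by simp)
  rintro _ ⟨_, ⟨a, rfl⟩, _, ⟨b, rfl⟩, rfl⟩
  simp only [hμ.measure_Iic_prod_Iic hC, hν.measure_Iic_prod_Iic hC]

theorem copulaMeasure_eq (h : IsCopulaMeasure C μ) (hC : C 1 1 = 1) : copulaMeasure C = μ := by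
  have hex : ∃ μ, IsCopulaMeasure C μ := ⟨μ, h⟩
  rw [copulaMeasure, dif_pos hex]
  exact hex.choose_spec.unique h hC

end IsCopulaMeasure

/-! ### The Kendall law and a sampling representation of the copula. -/

/-- For finite positive `c` and finite `a`, `b` the set is the interval from `a/c` to `1 - b/c`. The
remaining cases agree with the conventions for division and truncated subtraction in `ℝ≥0∞`. -/
theorem volume_restrict_setOf_le_mul_and_le_mul (a b c : ℝ≥0∞) :
    (volume.restrict (Icc (0 : ℝ) 1))
      {u | a ≤ ENNReal.ofReal u * c ∧ b ≤ ENNReal.ofReal (1 - u) * c} = 1 - (a + b) / c := by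
  -- Dropping the endpoints avoids the products `0 * ⊤ = 0` when `c = ⊤`.
  rw [Measure.restrict_congr_set (Ioo_ae_eq_Icc (a := (0 : ℝ)) (b := 1)).symm,
    Measure.restrict_apply' measurableSet_Ioo]
  rcases eq_or_ne c 0 with rfl | hc0
  · rcases eq_or_ne (a + b) 0 with hab | hab
    · obtain ⟨rfl, rfl⟩ := add_eq_zero.1 hab
      simp
    · rw [ENNReal.div_zero hab]
      have : ¬ (a = 0 ∧ b = 0) := fun h => hab (by simp [h.1, h.2])
      simp [this]
  rcases eq_or_ne c ⊤ with rfl | hct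
  · have : {u | a ≤ ENNReal.ofReal u * ⊤ ∧ b ≤ ENNReal.ofReal (1 - u) * ⊤} ∩ Ioo (0 : ℝ) 1
        = Ioo 0 1 := by
      refine inter_eq_right.2 fun u hu => ?_
      have h1 : ENNReal.ofReal u ≠ 0 := (ENNReal.ofReal_pos.2 hu.1).ne'
      have h2 : ENNReal.ofReal (1 - u) ≠ 0 := (ENNReal.ofReal_pos.2 (sub_pos.2 hu.2)).ne'
      simp only [mem_ofPred_eq, ENNReal.mul_top h1, ENNReal.mul_top h2, le_top, and_self]
    rw [this]
    simp
  rcases eq_or_ne (a + b) ⊤ with hab | hab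
  · rw [hab, ENNReal.top_div_of_ne_top hct]
    have : {u | a ≤ ENNReal.ofReal u * c ∧ b ≤ ENNReal.ofReal (1 - u) * c} = ∅ := by
      refine eq_empty_of_forall_notMem fun u hu => ?_
      have h1 := ENNReal.mul_ne_top (a := ENNReal.ofReal u) ENNReal.ofReal_ne_top hct
      have h2 := ENNReal.mul_ne_top (a := ENNReal.ofReal (1 - u)) ENNReal.ofReal_ne_top hct
      exact (ENNReal.add_ne_top.2 ⟨(hu.1.trans_lt h1.lt_top).ne, (hu.2.trans_lt h2.lt_top).ne⟩) hab
    simp [this]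
  obtain ⟨ha, hb⟩ := ENNReal.add_ne_top.1 hab
  lift a to ℝ≥0 using ha
  lift b to ℝ≥0 using hb
  lift c to ℝ≥0 using hct
  have hc : (0 : ℝ) < c := by
    have : c ≠ 0 := by exact_mod_cast hc0
    positivity
  have key : ∀ (d : ℝ≥0) (u : ℝ), 0 ≤ u → ((d : ℝ≥0∞) ≤ ENNReal.ofReal u * c ↔ (d : ℝ) / c ≤ u) :=
    fun d u hu => by
      rw [div_le_iff₀ hc, ← ENNReal.ofReal_coe_nnreal, ← ENNReal.ofReal_coe_nnreal (p := c),
        ← ENNReal.ofReal_mul hu, ENNReal.ofReal_le_ofReal_iff (by positivity)]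
  have hset : {u | (a : ℝ≥0∞) ≤ ENNReal.ofReal u * c ∧ (b : ℝ≥0∞) ≤ ENNReal.ofReal (1 - u) * c} ∩
      Ioo (0 : ℝ) 1 = Icc ((a : ℝ) / c) (1 - b / c) ∩ Ioo 0 1 := by
    ext u
    simp only [mem_inter_iff, mem_ofPred_eq, mem_Icc]
    refine and_congr_left fun hu => ?_
    rw [key a u hu.1.le, key b (1 - u) (sub_nonneg.2 hu.2.le)]
    exact and_congr_right fun _ => le_sub_comm
  have hset2 : (Icc ((a : ℝ) / c) (1 - b / c) ∩ Ioo 0 1 : Set ℝ) =ᵐ[volume]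
      Icc ((a : ℝ) / c) (1 - b / c) := by
    have : (Icc ((a : ℝ) / c) (1 - b / c) ∩ Icc 0 1 : Set ℝ) = Icc ((a : ℝ) / c) (1 - b / c) := by
      refine inter_eq_left.2 (Icc_subset_Icc (by positivity) ?_)
      have : (0 : ℝ) ≤ b / c := by positivity
      linarith
    nth_rewrite 2 [← this]
    exact (ae_eq_refl _).inter Ioo_ae_eq_Icc
  rw [hset, measure_congr hset2, Real.volume_Icc, ENNReal.ofReal_sub _ (by positivity),
    ENNReal.ofReal_sub _ (by positivity), ENNReal.ofReal_div_of_pos hc,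
    ENNReal.ofReal_div_of_pos hc, tsub_tsub]
  simp only [ENNReal.ofReal_one, ENNReal.ofReal_coe_nnreal]
  rw [add_comm, ENNReal.add_div]

noncomputable section

/-- The point at which the right tangent line of `φ` at `t` meets the axis; on `(0,1)` this is the
Kendall distribution function of the Archimedean copula induced by `φ`. -/
def tangentRoot (φ : ℝ → ℝ≥0∞) (t : ℝ) : ℝ :=
  t - (φ t).toReal / rightDerivative φ t

/-- The function `tangentRoot φ` on `(0,1)`, extended by the values `0` and `1`. -/
def tangentRootExtension (φ : ℝ → ℝ≥0∞) (t : ℝ) : ℝ :=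
  if t ≤ 0 then 0 else if t < 1 then tangentRoot φ t else 1

/-- The nearest point to `w` in `[0,1]`. -/
def clamp (w : ℝ) : ℝ := max 0 (min 1 w)

/-- For `U` uniform on `[0,1]` and `W` with law `kendallMeasure`, the pair
`(φ⁻(U φ(W)), φ⁻((1 - U) φ(W)))` is distributed according to the Archimedean copula. -/
def samplingMap (φ : ℝ → ℝ≥0∞) (q : ℝ × ℝ) : ℝ × ℝ :=
  (pseudoInverse φ (ENNReal.ofReal q.1 * φ (clamp q.2)),
    pseudoInverse φ (ENNReal.ofReal (1 - q.1) * φ (clamp q.2)))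

theorem clamp_mem (w : ℝ) : clamp w ∈ Icc (0 : ℝ) 1 :=
  ⟨le_max_left _ _, max_le zero_le_one (min_le_left _ _)⟩

theorem clamp_of_mem {w : ℝ} (hw : w ∈ Icc (0 : ℝ) 1) : clamp w = w := by
  rw [clamp, min_eq_right hw.2, max_eq_right hw.1]

theorem monotone_clamp : Monotone clamp := fun _ _ h =>
  max_le_max le_rfl (min_le_min le_rfl h)

theorem clamp_le_iff {w t : ℝ} (ht : t ∈ Ioo (0 : ℝ) 1) : clamp w ≤ t ↔ w ≤ t := by
  simp only [clamp, max_le_iff, min_le_iff, ht.1.le, true_and, not_le.2 ht.2, false_or]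

namespace IsGenerator

variable {φ : ℝ → ℝ≥0∞}

/-- Nothing is known about `φ` outside `[0,1]`; clamping makes the composite antitone on all of `ℝ`.
-/
theorem measurable_comp_clamp (h : IsGenerator φ) : Measurable fun w => φ (clamp w) := by
  have : Antitone fun w => φ (clamp w) := fun a b hab =>
    h.strictAntiOn.antitoneOn (clamp_mem a) (clamp_mem b) (monotone_clamp hab)
  exact this.measurable

theorem lt_tangentRoot (h : IsGenerator φ) {t : ℝ} (ht : t ∈ Ioo (0 : ℝ) 1) :
    t < tangentRoot φ t := by
  have := div_neg_of_pos_of_neg (h.toReal_pos ht) (h.rightDerivative_neg ht)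
  rw [tangentRoot]; linarith

theorem tangentRoot_le_one (h : IsGenerator φ) {t : ℝ} (ht : t ∈ Ioo (0 : ℝ) 1) :
    tangentRoot φ t ≤ 1 := by
  have h1 := h.rightDerivative_le_slope ht.1 ht.2 le_rfl
  rw [h.toReal_one, le_div_iff₀ (by linarith [ht.2])] at h1
  have : t - 1 ≤ (φ t).toReal / rightDerivative φ t := by
    rw [le_div_iff_of_neg (h.rightDerivative_neg ht)]; linarith
  rw [tangentRoot]; linarith

/-- The tangent at `s` passes below `(t, φ t)`, so the parallel line through that point has its root
further right (`h3`); the flatter slope at `t` moves the root right again (`h2`). -/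
theorem monotoneOn_tangentRoot (h : IsGenerator φ) :
    MonotoneOn (tangentRoot φ) (Ioo (0 : ℝ) 1) := by
  intro s hs t ht hst
  rcases hst.eq_or_lt with rfl | hst
  · exact le_rfl
  have hDs := h.rightDerivative_neg hs
  have hDt := h.rightDerivative_neg ht
  have h1 := h.rightDerivative_le_slope hs.1 hst ht.2.le
  rw [le_div_iff₀ (sub_pos.2 hst)] at h1
  have h2 : (φ t).toReal / rightDerivative φ t ≤ (φ t).toReal / rightDerivative φ s :=
by
    have h4 : rightDerivative φ t / rightDerivative φ s ≤ 1 :=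
      (div_le_one_of_neg hDs).2 (h.monotoneOn_rightDerivative hs ht hst.le)
    rw [div_le_iff_of_neg hDt, div_mul_eq_mul_div, mul_div_assoc]
    exact mul_le_of_le_one_right ENNReal.toReal_nonneg h4
  have h3 : (φ t).toReal / rightDerivative φ s ≤ t - s + (φ s).toReal / rightDerivative φ s := by
    rw [div_le_iff_of_neg hDs, add_mul, div_mul_cancel₀ _ hDs.ne]; linarith
  simp only [tangentRoot]
  linarith

theorem monotone_tangentRootExtension (h : IsGenerator φ) :
    Monotone (tangentRootExtension φ) := by
  intro s t hst
  unfold tangentRootExtension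
  rcases le_or_gt s 0 with hs0 | hs0
  · rw [if_pos hs0]
    split_ifs with h2 h3
    · exact le_rfl
    · exact (not_le.1 h2).le.trans (h.lt_tangentRoot ⟨not_le.1 h2, h3⟩).le
    · exact zero_le_one
  · rw [if_neg hs0.not_ge, if_neg (hs0.trans_le hst).not_ge]
    split_ifs with h2 h3 h3
    · exact h.monotoneOn_tangentRoot ⟨hs0, h2⟩ ⟨hs0.trans_le hst, h3⟩ hst
    · exact h.tangentRoot_le_one ⟨hs0, h2⟩
    · exact absurd (hst.trans_lt h3) h2
    · exact le_rfl

/-- The law of `C(X,Y)` under the Archimedean copula `C` induced by `φ`. -/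
def kendallMeasure (h : IsGenerator φ) : Measure ℝ :=
  h.monotone_tangentRootExtension.stieltjesFunction.measure

theorem tendsto_stieltjes_atBot (h : IsGenerator φ) :
    Tendsto h.monotone_tangentRootExtension.stieltjesFunction atBot (𝓝 0) := by
  refine tendsto_const_nhds.congr' ?_
  filter_upwards [Iio_mem_atBot (0 : ℝ)] with x hx
  rw [Monotone.stieltjesFunction_eq, rightLim_eq_of_tendsto]
  refine tendsto_const_nhds.congr' ?_
  filter_upwards [mem_nhdsWithin_of_mem_nhds (Iio_mem_nhds hx)] with y hy
  rw [tangentRootExtension, if_pos (le_of_lt hy)]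

theorem tendsto_stieltjes_atTop (h : IsGenerator φ) :
    Tendsto h.monotone_tangentRootExtension.stieltjesFunction atTop (𝓝 1) := by
  refine tendsto_const_nhds.congr' ?_
  filter_upwards [Ioi_mem_atTop (1 : ℝ)] with x hx
  rw [Monotone.stieltjesFunction_eq, rightLim_eq_of_tendsto]
  refine tendsto_const_nhds.congr' ?_
  filter_upwards [mem_nhdsWithin_of_mem_nhds (Ioi_mem_nhds hx)] with y hy
  have hy : 1 < y := hy
  rw [tangentRootExtension, if_neg (by linarith), if_neg (by linarith)]

theorem isProbabilityMeasure_kendallMeasure (h : IsGenerator φ) :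
    IsProbabilityMeasure h.kendallMeasure := by
  refine ⟨?_⟩
  rw [kendallMeasure, StieltjesFunction.measure_univ _ h.tendsto_stieltjes_atBot
    h.tendsto_stieltjes_atTop]
  simp

/-- Right-continuity of `D⁺φ` makes `tangentRoot` right-continuous, so passing to the Stieltjes
function changes no value on `(0,1)`. -/
theorem kendallMeasure_Iic (h : IsGenerator φ) {t : ℝ} (ht : t ∈ Ioo (0 : ℝ) 1) :
    h.kendallMeasure (Iic t) = ENNReal.ofReal (tangentRoot φ t) := by
  rw [kendallMeasure, StieltjesFunction.measure_Iic _ h.tendsto_stieltjes_atBot, sub_zero,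
    Monotone.stieltjesFunction_eq, rightLim_eq_of_tendsto]
  have hlim : Tendsto (tangentRoot φ) (𝓝[>] t) (𝓝 (tangentRoot φ t)) := by
    have hf : ContinuousAt (fun t => (φ t).toReal) t :=
      h.continuousOn_toReal.continuousAt (Ioc_mem_nhds ht.1 ht.2)
    exact (tendsto_id.mono_left nhdsWithin_le_nhds).sub
      ((hf.tendsto.mono_left nhdsWithin_le_nhds).div (h.continuousWithinAt_rightDerivative ht)
        (h.rightDerivative_neg ht).ne)
  refine hlim.congr' ?_
  filter_upwards [Ioo_mem_nhdsGT ht.2] with y hy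
  rw [tangentRootExtension, if_neg (by linarith [ht.1, hy.1]), if_pos hy.2]

theorem toReal_div_toReal_hasDerivWithinAt (h : IsGenerator φ) (c : ℝ) {v : ℝ}
    (hv : v ∈ Ioo (0 : ℝ) 1) :
    HasDerivWithinAt (fun v => c / (φ v).toReal)
      (-(c * rightDerivative φ v) / (φ v).toReal ^ 2) (Ioi v) v := by
  have := (hasDerivWithinAt_const v (Ioi v) c).div (h.hasDerivWithinAt hv) (h.toReal_pos hv).ne'
  rwa [zero_mul, zero_sub] at this

end IsGenerator

namespace IsNormalizedGenerator

variable {φ : ℝ → ℝ≥0∞}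

/-- Includes `v = 0`: if `φ 0 = ⊤`, the conventions `⊤.toReal = 0` and `x / 0 = 0` yield the correct
limit `0`. -/
theorem continuousOn_toReal_div_toReal (h : IsNormalizedGenerator φ) {z : ℝ}
    (hz : z ∈ Ioo (0 : ℝ) 1) :
    ContinuousOn (fun v => (φ z).toReal / (φ v).toReal) (Icc 0 z) := by
  have hzt := h.ne_top (Ioo_subset_Ioc_self hz)
  have h1 : ContinuousOn (fun v => φ z / φ v) (Icc 0 z) :=
    (ENNReal.continuous_const_mul hzt).comp_continuousOn
      (continuous_inv.comp_continuousOn (h.continuousOn.mono (Icc_subset_Icc_right hz.2.le)))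
  have h2 : ∀ v ∈ Icc 0 z, φ z / φ v ≠ ⊤ := fun v hv =>
    ENNReal.div_ne_top hzt (h.pos ⟨hv.1, hv.2.trans_lt hz.2⟩).ne'
  simp only [← ENNReal.toReal_div]
  exact ENNReal.continuousOn_toReal.comp h1 h2

/-- With `p(v) = φ(z)/φ(v)` and `p(z) = 1`, the integrand at `w` is the integral of `p' = G` from
`w` to `z`. Swapping integrals leaves `∫ F G` over `(0,z)`, and `F G = p + v G` is the right
derivative of `v p(v)`, giving `z`. -/
theorem lintegral_kendallMeasure_of_mem_Ioo (h : IsNormalizedGenerator φ) {z : ℝ}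
    (hz : z ∈ Ioo (0 : ℝ) 1) :
    ∫⁻ w, (1 - φ z / φ (clamp w)) ∂h.kendallMeasure = ENNReal.ofReal z := by
  have := h.isProbabilityMeasure_kendallMeasure
  set p : ℝ → ℝ := fun v => (φ z).toReal / (φ v).toReal with hp
  set G : ℝ → ℝ := fun v => derivWithin p (Ioi v) v with hG
  have hzt := h.ne_top (Ioo_subset_Ioc_self hz)
  have hmem : ∀ v ∈ Ioo 0 z, v ∈ Ioo (0 : ℝ) 1 := fun v hv => ⟨hv.1, hv.2.trans hz.2⟩
  have hGeq : ∀ v ∈ Ioo 0 z, G v = -((φ z).toReal * rightDerivative φ v) / (φ v).toReal ^ 2 :=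
    fun v hv => (h.toReal_div_toReal_hasDerivWithinAt _ (hmem v hv)).derivWithin
      (uniqueDiffWithinAt_Ioi v)
  have hGd : ∀ v ∈ Ioo 0 z, HasDerivWithinAt p (G v) (Ioi v) v := fun v hv => by
    rw [hGeq v hv]; exact h.toReal_div_toReal_hasDerivWithinAt _ (hmem v hv)
  have hG0 : ∀ v ∈ Ioo 0 z, 0 ≤ G v := fun v hv => by
    rw [hGeq v hv]
    have h1 := h.rightDerivative_neg (hmem v hv)
    have h2 := h.toReal_pos hz
    exact div_nonneg (by nlinarith) (sq_nonneg _)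
  have hpc := h.continuousOn_toReal_div_toReal hz
  have hpz : p z = 1 := div_self (h.toReal_pos hz).ne'
  have hGm : Measurable fun v => ENNReal.ofReal (G v) :=
    (measurable_derivWithin_Ioi p).ennreal_ofReal
  have hinner : ∀ w : ℝ, 1 - φ z / φ (clamp w) =
      ∫⁻ v in Ioo 0 z, (Ici w).indicator (fun v => ENNReal.ofReal (G v)) v := fun w => by
    rw [lintegral_indicator measurableSet_Ici, Measure.restrict_restrict measurableSet_Ici]
    rcases le_or_gt z w with hzw | hwz
    -- Here `φ z / φ (clamp w) ≥ 1`, and truncated subtraction gives `0`.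
    · have he : Ici w ∩ Ioo 0 z = ∅ := by
        refine eq_empty_of_forall_notMem fun v hv => ?_
        have := hv.1.out
        linarith [hv.2.2]
      rw [he, Measure.restrict_empty, lintegral_zero_measure, tsub_eq_zero_iff_le]
      have hle : φ (clamp w) ≤ φ z := h.strictAntiOn.antitoneOn ⟨hz.1.le, hz.2.le⟩ (clamp_mem w)
        (by rw [← clamp_of_mem ⟨hz.1.le, hz.2.le⟩]; exact monotone_clamp hzw)
      rw [ENNReal.le_div_iff_mul_le (Or.inr (h.pos ⟨hz.1.le, hz.2⟩).ne') (Or.inr hzt), one_mul]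
      exact hle
    · have hcl : clamp w = max 0 w := by rw [clamp, min_eq_right (hwz.trans hz.2).le]
      have hae : (Ici w ∩ Ioo 0 z : Set ℝ) =ᵐ[volume] Ioo (clamp w) z := by
        rcases le_or_gt w 0 with hw0 | hw0
        · have : Ici w ∩ Ioo 0 z = Ioo 0 z := inter_eq_right.2 fun v hv => hw0.trans hv.1.le
          rw [hcl, max_eq_left hw0, this]
          exact EventuallyEq.rfl
        · rw [hcl, max_eq_right hw0.le]
          have : Ici w ∩ Ioo 0 z = Ico w z := by
            ext v
            simp only [mem_inter_iff, mem_Ici, mem_Ioo, mem_Ico]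
            exact ⟨fun hv => ⟨hv.1, hv.2.2⟩, fun hv => ⟨hv.1, hw0.trans_le hv.1, hv.2⟩⟩
          rw [this]
          exact Ioo_ae_eq_Ico.symm
      have h0 := (clamp_mem w).1
      have hcz : clamp w ≤ z := by rw [hcl]; exact max_le hz.1.le hwz.le
      have hφc : φ (clamp w) ≠ 0 := (h.pos ⟨h0, hcz.trans_lt hz.2⟩).ne'
      rw [Measure.restrict_congr_set hae, lintegral_ofReal_eq_sub_of_hasDerivWithinAt_Ioi hcz
        (hpc.mono (Icc_subset_Icc_left h0)) (fun v hv => hGd v ⟨h0.trans_lt hv.1, hv.2⟩)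
        (fun v hv => hG0 v ⟨h0.trans_lt hv.1, hv.2⟩),
        div_self (h.toReal_pos hz).ne', ENNReal.ofReal_sub _ (by positivity), ENNReal.ofReal_one]
      simp only [← ENNReal.toReal_div]
      rw [ENNReal.ofReal_toReal (ENNReal.div_ne_top hzt hφc)]
  simp only [hinner]
  have hmeas : Measurable (Function.uncurry fun w v : ℝ =>
      (Ici w).indicator (fun v => ENNReal.ofReal (G v)) v) := by
    have : (Function.uncurry fun w v : ℝ => (Ici w).indicator (fun v => ENNReal.ofReal (G v)) v) =
        {x : ℝ × ℝ | x.1 ≤ x.2}.indicator (fun x => ENNReal.ofReal (G x.2)) := by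
      ext ⟨w, v⟩
      simp [Function.uncurry, indicator]
    rw [this]
    exact (hGm.comp measurable_snd).indicator (measurableSet_le measurable_fst measurable_snd)
  rw [lintegral_lintegral_swap hmeas.aemeasurable]
  have houter : ∀ v ∈ Ioo 0 z,
      ∫⁻ w, (Ici w).indicator (fun v => ENNReal.ofReal (G v)) v ∂h.kendallMeasure =
        ENNReal.ofReal (p v + v * G v) := fun v hv => by
    have : (fun w => (Ici w).indicator (fun v => ENNReal.ofReal (G v)) v) =
        (Iic v).indicator fun _ => ENNReal.ofReal (G v) := by
      ext w; simp [indicator]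
    rw [this, lintegral_indicator_const measurableSet_Iic, h.kendallMeasure_Iic (hmem v hv),
      ← ENNReal.ofReal_mul (hG0 v hv), hGeq v hv, tangentRoot]
    congr 1
    have h1 := (h.rightDerivative_neg (hmem v hv)).ne
    have h2 := (h.toReal_pos (hmem v hv)).ne'
    simp only [hp]
    field_simp
    ring
  rw [setLIntegral_congr_fun measurableSet_Ioo houter,
    lintegral_ofReal_eq_sub_of_hasDerivWithinAt_Ioi (p := fun v => v * p v) hz.1.le
      (continuousOn_id.mul hpc)]
  · simp [hpz]
  · intro v hv
    have := (hasDerivWithinAt_id v (Ioi v)).mul (hGd v hv)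
    rwa [one_mul] at this
  · intro v hv
    have := hG0 v hv
    have := hv.1
    simp only [hp]
    positivity

/-- If `s ≥ φ 0`, the integral is at most the one for `φ z`, namely `z`, for every small `z > 0`,
hence zero. -/
theorem lintegral_kendallMeasure (h : IsNormalizedGenerator φ) (s : ℝ≥0∞) :
    ∫⁻ w, (1 - s / φ (clamp w)) ∂h.kendallMeasure = ENNReal.ofReal (pseudoInverse φ s) := by
  have := h.isProbabilityMeasure_kendallMeasure
  rcases lt_or_ge s (φ 0) with hs | hs
  · obtain ⟨z, hz, rfl⟩ := h.exists_eq hs.le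
    rw [h.pseudoInverse_map hz]
    rcases hz.1.eq_or_lt with rfl | h0
    · exact absurd hs (lt_irrefl _)
    rcases hz.2.eq_or_lt with rfl | h1
    · simp [h.map_one]
    · exact h.lintegral_kendallMeasure_of_mem_Ioo ⟨h0, h1⟩
  · have h0 : pseudoInverse φ s = 0 := le_antisymm
      ((h.pseudoInverse_le_iff (by simp)).2 hs) (h.pseudoInverse_mem s).1
    rw [h0, ENNReal.ofReal_zero, ← nonpos_iff_eq_zero]
    have hlim : Tendsto (fun z : ℝ => ENNReal.ofReal z) (𝓝[>] 0) (𝓝 0) := by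
      have := ENNReal.continuous_ofReal.tendsto 0
      rw [ENNReal.ofReal_zero] at this
      exact this.mono_left nhdsWithin_le_nhds
    refine ge_of_tendsto hlim ?_
    filter_upwards [Ioo_mem_nhdsGT zero_lt_one] with z hz
    rw [← h.lintegral_kendallMeasure_of_mem_Ioo hz]
    refine lintegral_mono fun w => tsub_le_tsub_left (ENNReal.div_le_div_right ?_ _) _
    exact (h.strictAntiOn.antitoneOn (by simp) ⟨hz.1.le, hz.2.le⟩ hz.1.le).trans hs

theorem measurable_samplingMap (h : IsNormalizedGenerator φ) : Measurable (samplingMap φ) := by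
  have hφ : Measurable fun q : ℝ × ℝ => φ (clamp q.2) := h.measurable_comp_clamp.comp measurable_snd
  have hψ := h.antitone_pseudoInverse.measurable
  exact (hψ.comp (measurable_fst.ennreal_ofReal.mul hφ)).prodMk
    (hψ.comp ((measurable_const.sub measurable_fst).ennreal_ofReal.mul hφ))

/-- For fixed `w` the admissible `u` have measure `1 - (φ x + φ y) / φ (clamp w)`; integrating over
`w` gives the pseudoinverse of `φ x + φ y`. -/
theorem isCopulaMeasure_map_samplingMap (h : IsNormalizedGenerator φ) :
    IsCopulaMeasure (archimedeanCopula φ)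
      (((volume.restrict (Icc (0 : ℝ) 1)).prod h.kendallMeasure).map (samplingMap φ)) := by
  have := h.isProbabilityMeasure_kendallMeasure
  have : IsProbabilityMeasure (volume.restrict (Icc (0 : ℝ) 1)) := ⟨by simp⟩
  refine ⟨Measure.isProbabilityMeasure_map h.measurable_samplingMap.aemeasurable,
    fun x hx y hy => ?_⟩
  have hs : MeasurableSet (Icc 0 x ×ˢ Icc 0 y) := measurableSet_Icc.prod measurableSet_Icc
  have hpre : ∀ w : ℝ, (fun u : ℝ => (u, w)) ⁻¹' (samplingMap φ ⁻¹' (Icc 0 x ×ˢ Icc 0 y)) =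
      {u | φ x ≤ ENNReal.ofReal u * φ (clamp w) ∧ φ y ≤ ENNReal.ofReal (1 - u) * φ (clamp w)} := by
    intro w
    ext u
    simp only [mem_preimage, samplingMap, mem_prod, mem_Icc, mem_ofPred_eq,
      h.pseudoInverse_le_iff hx, h.pseudoInverse_le_iff hy, (h.pseudoInverse_mem _).1, true_and]
  rw [measureReal_def, Measure.map_apply h.measurable_samplingMap hs,
    Measure.prod_apply_symm (h.measurable_samplingMap hs)]
  simp only [hpre, volume_restrict_setOf_le_mul_and_le_mul]
  rw [h.lintegral_kendallMeasure, ENNReal.toReal_ofReal (h.pseudoInverse_mem _).1,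
    archimedeanCopula]

/-- The two generator values add up to `(u + (1 - u)) φ(w) = φ(w)`; neither is truncated, as both
are at most `φ 0`. -/
theorem archimedeanCopula_samplingMap (h : IsNormalizedGenerator φ) {q : ℝ × ℝ}
    (hq : q.1 ∈ Icc (0 : ℝ) 1) :
    archimedeanCopula φ (samplingMap φ q).1 (samplingMap φ q).2 = clamp q.2 := by
  have hle : φ (clamp q.2) ≤ φ 0 :=
    h.strictAntiOn.antitoneOn (by simp) (clamp_mem _) (clamp_mem _).1
  have h1 : ∀ u : ℝ, u ≤ 1 → ENNReal.ofReal u * φ (clamp q.2) ≤ φ 0 := fun u hu =>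
    (mul_le_of_le_one_left zero_le (ENNReal.ofReal_le_one.2 hu)).trans hle
  rw [archimedeanCopula, samplingMap, h.map_pseudoInverse, h.map_pseudoInverse,
    min_eq_left (h1 _ hq.2), min_eq_left (h1 _ (by linarith [hq.1])), ← add_mul,
    ← ENNReal.ofReal_add hq.1 (by linarith [hq.2]), add_sub_cancel, ENNReal.ofReal_one, one_mul,
    h.pseudoInverse_map (clamp_mem _)]

theorem kendallDistribution_eq (h : IsNormalizedGenerator φ) {t : ℝ} (ht : t ∈ Ioo (0 : ℝ) 1) :
    kendallDistribution (archimedeanCopula φ) t = tangentRoot φ t := by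
  have := h.isProbabilityMeasure_kendallMeasure
  have : IsProbabilityMeasure (volume.restrict (Icc (0 : ℝ) 1)) := ⟨by simp⟩
  have hC : archimedeanCopula φ 1 1 = 1 := by
    rw [archimedeanCopula, h.map_one, add_zero, ← h.map_one, h.pseudoInverse_map (by simp)]
  have hset : MeasurableSet {p : ℝ × ℝ | p ∈ Icc (0 : ℝ) 1 ×ˢ Icc (0 : ℝ) 1 ∧
      archimedeanCopula φ p.1 p.2 ≤ t} := by
    have he : {p : ℝ × ℝ | p ∈ Icc (0 : ℝ) 1 ×ˢ Icc (0 : ℝ) 1 ∧ archimedeanCopula φ p.1 p.2 ≤ t} =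
        Icc (0 : ℝ) 1 ×ˢ Icc (0 : ℝ) 1 ∩
          {p : ℝ × ℝ | pseudoInverse φ (φ (clamp p.1) + φ (clamp p.2)) ≤ t} := by
      ext p
      refine and_congr_right fun hp => ?_
      rw [mem_ofPred_eq, clamp_of_mem hp.1, clamp_of_mem hp.2, archimedeanCopula]
    rw [he]
    refine (measurableSet_Icc.prod measurableSet_Icc).inter (measurableSet_le ?_ measurable_const)
    exact h.antitone_pseudoInverse.measurable.comp
      ((h.measurable_comp_clamp.comp measurable_fst).add
        (h.measurable_comp_clamp.comp measurable_snd))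
  rw [kendallDistribution, h.isCopulaMeasure_map_samplingMap.copulaMeasure_eq hC,
    measureReal_def, Measure.map_apply h.measurable_samplingMap hset]
  have hae : (samplingMap φ ⁻¹' {p : ℝ × ℝ | p ∈ Icc (0 : ℝ) 1 ×ˢ Icc (0 : ℝ) 1 ∧
      archimedeanCopula φ p.1 p.2 ≤ t} : Set (ℝ × ℝ))
      =ᵐ[(volume.restrict (Icc (0 : ℝ) 1)).prod h.kendallMeasure] univ ×ˢ Iic t := by
    have h1 : ∀ᵐ q ∂(volume.restrict (Icc (0 : ℝ) 1)).prod h.kendallMeasure,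
        q.1 ∈ Icc (0 : ℝ) 1 :=
      Measure.quasiMeasurePreserving_fst.ae (ae_restrict_mem measurableSet_Icc)
    filter_upwards [h1] with q hq
    refine propext ?_
    change samplingMap φ q ∈ Icc (0 : ℝ) 1 ×ˢ Icc (0 : ℝ) 1 ∧
      archimedeanCopula φ (samplingMap φ q).1 (samplingMap φ q).2 ≤ t ↔ q ∈ univ ×ˢ Iic t
    rw [h.archimedeanCopula_samplingMap hq, clamp_le_iff ht]
    have : samplingMap φ q ∈ Icc (0 : ℝ) 1 ×ˢ Icc (0 : ℝ) 1 :=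
      ⟨h.pseudoInverse_mem _, h.pseudoInverse_mem _⟩
    simp only [this, true_and, mem_prod, mem_univ, mem_Iic]
  rw [measure_congr hae, Measure.prod_prod, measure_univ, one_mul, h.kendallMeasure_Iic ht,
    ENNReal.toReal_ofReal (ht.1.trans (h.lt_tangentRoot ht)).le]

end IsNormalizedGenerator

end

/-! ### Recovering the generator from its derivative or its Kendall function. -/

namespace IsGenerator

variable {φ : ℝ → ℝ≥0∞}

theorem countable_diff_contPoints (h : IsGenerator φ) :
    (Ioo (0 : ℝ) 1 \ contPoints φ).Countable := by
  refine h.monotoneOn_rightDerivative.countable_not_continuousWithinAt.mono fun x hx => ?_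
  refine ⟨hx.1, fun hc => hx.2 ⟨hx.1, hc.continuousAt (Ioo_mem_nhds hx.1.1 hx.1.2)⟩⟩

theorem exists_mem_contPoints (h : IsGenerator φ) {a b : ℝ} (ha : 0 ≤ a) (hab : a < b)
    (hb : b ≤ 1) : ∃ x ∈ contPoints φ, a < x ∧ x < b := by
  obtain ⟨x, hx, hax, hxb⟩ := (h.countable_diff_contPoints.dense_compl ℝ).exists_between hab
  refine ⟨x, ?_, hax, hxb⟩
  by_contra hc
  exact hx ⟨⟨ha.trans_lt hax, hxb.trans_le hb⟩, hc⟩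

theorem ae_mem_contPoints (h : IsGenerator φ) :
    ∀ᵐ x : ℝ, x ∈ Ioo (0 : ℝ) 1 → x ∈ contPoints φ := by
  filter_upwards [h.countable_diff_contPoints.ae_notMem volume] with x hx hx1
  by_contra hc
  exact hx ⟨hx1, hc⟩

theorem intervalIntegrable_rightDerivative (h : IsGenerator φ) {x : ℝ} (hx : x ∈ Ioo (0 : ℝ) 1) :
    IntervalIntegrable (rightDerivative φ) volume x 1 := by
  rw [intervalIntegrable_iff_integrableOn_Ioc_of_le hx.2.le]
  have := intervalIntegral.integrableOn_deriv_right_of_nonneg (a := x) (b := 1)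
    (g := fun t => -(φ t).toReal) (g' := fun t => -rightDerivative φ t)
    (h.continuousOn_toReal.mono fun t ht => ⟨hx.1.trans_le ht.1, ht.2⟩).neg
    (fun t ht => (h.hasDerivWithinAt ⟨hx.1.trans ht.1, ht.2⟩).neg)
    (fun t ht => (neg_pos.2 (h.rightDerivative_neg ⟨hx.1.trans ht.1, ht.2⟩)).le)
  simpa using this.neg

theorem integral_rightDerivative (h : IsGenerator φ) {x : ℝ} (hx : x ∈ Ioo (0 : ℝ) 1) :
    ∫ v in x..1, rightDerivative φ v = -(φ x).toReal := by
  rw [intervalIntegral.integral_eq_sub_of_hasDeriv_right (f := fun t => (φ t).toReal) _ _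
    (h.intervalIntegrable_rightDerivative hx), h.toReal_one, zero_sub]
  · rw [uIcc_of_le hx.2.le]
    exact h.continuousOn_toReal.mono fun t ht => ⟨hx.1.trans_le ht.1, ht.2⟩
  · rw [min_eq_left hx.2.le, max_eq_right hx.2.le]
    exact fun t ht => h.hasDerivWithinAt ⟨hx.1.trans ht.1, ht.2⟩

theorem inv_tangentRoot_sub (t : ℝ) :
    (tangentRoot φ t - t)⁻¹ = -(rightDerivative φ t / (φ t).toReal) := by
  rw [tangentRoot, sub_sub_cancel_left, inv_neg, inv_div]

theorem hasDerivWithinAt_neg_log (h : IsGenerator φ) {t : ℝ} (ht : t ∈ Ioo (0 : ℝ) 1) :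
    HasDerivWithinAt (fun t => -Real.log (φ t).toReal) (tangentRoot φ t - t)⁻¹ (Ioi t) t := by
  rw [inv_tangentRoot_sub]
  exact ((h.hasDerivWithinAt ht).log (h.toReal_pos ht).ne').neg

theorem continuousOn_neg_log (h : IsGenerator φ) :
    ContinuousOn (fun t => -Real.log (φ t).toReal) (Ioo (0 : ℝ) 1) :=
  ((h.continuousOn_toReal.mono Ioo_subset_Ioc_self).log fun _ ht => (h.toReal_pos ht).ne').neg

theorem intervalIntegrable_inv_tangentRoot_sub (h : IsGenerator φ) {a b : ℝ}
    (ha : a ∈ Ioo (0 : ℝ) 1) (hb : b ∈ Ioo (0 : ℝ) 1) :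
    IntervalIntegrable (fun v => (tangentRoot φ v - v)⁻¹) volume a b := by
  have hsub : uIcc a b ⊆ Ioo 0 1 := ordConnected_Ioo.uIcc_subset ha hb
  rw [intervalIntegrable_iff]
  refine intervalIntegral.integrableOn_deriv_right_of_nonneg (h.continuousOn_neg_log.mono hsub)
    (fun t ht => h.hasDerivWithinAt_neg_log (hsub (Ioo_subset_Icc_self ht))) fun t ht => ?_
  exact inv_nonneg.2 (sub_pos.2 (h.lt_tangentRoot (hsub (Ioo_subset_Icc_self ht)))).le

theorem integral_inv_tangentRoot_sub (h : IsGenerator φ) {a b : ℝ}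
    (ha : a ∈ Ioo (0 : ℝ) 1) (hb : b ∈ Ioo (0 : ℝ) 1) :
    ∫ v in a..b, (tangentRoot φ v - v)⁻¹ =
      -Real.log (φ b).toReal - -Real.log (φ a).toReal := by
  have hsub : uIcc a b ⊆ Ioo 0 1 := ordConnected_Ioo.uIcc_subset ha hb
  exact intervalIntegral.integral_eq_sub_of_hasDeriv_right (h.continuousOn_neg_log.mono hsub)
    (fun t ht => h.hasDerivWithinAt_neg_log (hsub (Ioo_subset_Icc_self ht)))
    (h.intervalIntegrable_inv_tangentRoot_sub ha hb)

end IsGenerator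

/-! ### Convergence of generators, derivatives, Kendall functions and copulas. -/

section Convergence

variable {φ : ℝ → ℝ≥0∞} {φs : ℕ → ℝ → ℝ≥0∞}

theorem tendsto_toReal_generator_iff (h : IsGenerator φ) (hs : ∀ n, IsGenerator (φs n)) {x : ℝ}
    (hx : x ∈ Ioc (0 : ℝ) 1) :
    Tendsto (fun n => (φs n x).toReal) atTop (𝓝 (φ x).toReal) ↔
      Tendsto (fun n => φs n x) atTop (𝓝 (φ x)) :=
  ENNReal.tendsto_toReal_iff (fun n => (hs n).ne_top hx) (h.ne_top hx)

/-- For `y` near `x` on either side, `D⁺φₙ(x)` is bounded by the slope of `φₙ` between `x` and `y`.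
These slopes converge, and continuity of `D⁺φ` at `x` makes their limits close to `D⁺φ(x)`. -/
theorem tendsto_rightDerivative_of_tendsto_generator (h : IsGenerator φ)
    (hs : ∀ n, IsGenerator (φs n))
    (hc : ∀ x ∈ Ioc (0 : ℝ) 1, Tendsto (fun n => φs n x) atTop (𝓝 (φ x)))
    {x : ℝ} (hx : x ∈ contPoints φ) :
    Tendsto (fun n => rightDerivative (φs n) x) atTop (𝓝 (rightDerivative φ x)) := by
  have hslope : ∀ y ∈ Ioo (0 : ℝ) 1, ∀ z ∈ Ioo (0 : ℝ) 1,
      Tendsto (fun n => ((φs n z).toReal - (φs n y).toReal) / (z - y)) atTop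
        (𝓝 (((φ z).toReal - (φ y).toReal) / (z - y))) := fun y hy z hz =>
    ((((tendsto_toReal_generator_iff h hs (Ioo_subset_Ioc_self hz)).2
      (hc z (Ioo_subset_Ioc_self hz))).sub
      ((tendsto_toReal_generator_iff h hs (Ioo_subset_Ioc_self hy)).2
      (hc y (Ioo_subset_Ioc_self hy))))).div_const _
  refine tendsto_order.2 ⟨fun a ha => ?_, fun a ha => ?_⟩
  · have h1 : ∀ᶠ y in 𝓝[<] x, a < rightDerivative φ y :=
      (hx.2.tendsto.mono_left nhdsWithin_le_nhds).eventually (lt_mem_nhds ha)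
    obtain ⟨y, hy, hy0⟩ := (h1.and (Ioo_mem_nhdsLT hx.1.1)).exists
    have hy1 : y ∈ Ioo (0 : ℝ) 1 := ⟨hy0.1, hy0.2.trans hx.1.2⟩
    filter_upwards [(hslope y hy1 x hx.1).eventually
      (lt_mem_nhds (hy.trans_le (h.rightDerivative_le_slope hy0.1 hy0.2 hx.1.2.le)))] with n hn
    exact hn.trans_le ((hs n).slope_le_rightDerivative hy0.1 hy0.2 hx.1.2)
  · have h1 : ∀ᶠ y in 𝓝[>] x, rightDerivative φ y < a :=
      (hx.2.tendsto.mono_left nhdsWithin_le_nhds).eventually (gt_mem_nhds ha)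
    obtain ⟨y, hy, hy0⟩ := (h1.and (Ioo_mem_nhdsGT hx.1.2)).exists
    have hy1 : y ∈ Ioo (0 : ℝ) 1 := ⟨hx.1.1.trans hy0.1, hy0.2⟩
    filter_upwards [(hslope x hx.1 y hy1).eventually
      (gt_mem_nhds ((h.slope_le_rightDerivative hx.1.1 hy0.1 hy0.2).trans_lt hy))] with n hn
    exact ((hs n).rightDerivative_le_slope hx.1.1 hy0.1 hy0.2.le).trans_lt hn

theorem tendsto_generator_of_tendsto_rightDerivative (h : IsGenerator φ)
    (hs : ∀ n, IsGenerator (φs n))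
    (hd : ∀ x ∈ contPoints φ,
      Tendsto (fun n => rightDerivative (φs n) x) atTop (𝓝 (rightDerivative φ x)))
    {x : ℝ} (hx : x ∈ Ioc (0 : ℝ) 1) : Tendsto (fun n => φs n x) atTop (𝓝 (φ x)) := by
  rcases hx.2.lt_or_eq with hx1 | rfl
  swap
  · simp only [h.map_one, (hs _).map_one]
    exact tendsto_const_nhds
  have hx' : x ∈ Ioo (0 : ℝ) 1 := ⟨hx.1, hx1⟩
  rw [← tendsto_toReal_generator_iff h hs hx, ← tendsto_neg_iff]
  simp only [← h.integral_rightDerivative hx', ← (hs _).integral_rightDerivative hx']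
  -- A continuity point left of `x`: by monotonicity `-D⁺φₙ(c)` dominates `-D⁺φₙ` on `(x,1)`, and it
  -- converges.
  obtain ⟨c, hc, hc0, hcx⟩ := h.exists_mem_contPoints le_rfl hx.1 hx.2
  have hne : ∀ᵐ v : ℝ, v ≠ 1 := (countable_singleton (1 : ℝ)).ae_notMem volume
  refine intervalIntegral.tendsto_integral_filter_of_dominated_convergence
    (fun _ => -(rightDerivative φ c - 1)) (Eventually.of_forall fun n => ?_) ?_
    intervalIntegrable_const ?_
  · exact (measurable_derivWithin_Ioi _).aestronglyMeasurable
  · filter_upwards [(hd c hc).eventually (lt_mem_nhds (sub_one_lt (rightDerivative φ c)))] with n hn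
    filter_upwards [hne] with v hv hvI
    rw [uIoc_of_le hx.2] at hvI
    have hv01 : v ∈ Ioo (0 : ℝ) 1 := ⟨hx.1.trans hvI.1, lt_of_le_of_ne hvI.2 hv⟩
    have hcv := (hs n).monotoneOn_rightDerivative hc.1 hv01 (hcx.trans hvI.1).le
    rw [Real.norm_of_nonpos ((hs n).rightDerivative_neg hv01).le]
    linarith
  · filter_upwards [hne, h.ae_mem_contPoints] with v hv hvc hvI
    rw [uIoc_of_le hx.2] at hvI
    exact hd v (hvc ⟨hx.1.trans hvI.1, lt_of_le_of_ne hvI.2 hv⟩)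

/-- By compactness a local bound suffices. Near `u`, monotonicity of `Fₙ` transfers the gap at a
continuity point `a < u` to all `v` slightly beyond `a`. -/
theorem exists_forall_le_tangentRoot_sub (h : IsGenerator φ) (hs : ∀ n, IsGenerator (φs n))
    (hb : ∀ x ∈ contPoints φ, Tendsto (fun n => tangentRoot (φs n) x) atTop (𝓝 (tangentRoot φ x)))
    {s : Set ℝ} (hsc : IsCompact s) (hs01 : s ⊆ Ioo 0 1) :
    ∃ δ > 0, ∀ᶠ n in atTop, ∀ v ∈ s, δ ≤ tangentRoot (φs n) v - v := by
  refine hsc.induction_on ⟨1, one_pos, by simp⟩ ?_ ?_ ?_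
  · rintro s t hst ⟨δ, hδ, ht⟩
    exact ⟨δ, hδ, ht.mono fun n hn v hv => hn v (hst hv)⟩
  · rintro s t ⟨δ, hδ, hs⟩ ⟨ε, hε, ht⟩
    refine ⟨min δ ε, lt_min hδ hε, ?_⟩
    filter_upwards [hs, ht] with n h1 h2 v hv
    rcases hv with hv | hv
    · exact (min_le_left _ _).trans (h1 v hv)
    · exact (min_le_right _ _).trans (h2 v hv)
  · intro u hu
    have hu := hs01 hu
    obtain ⟨c, hc0, hcu⟩ := exists_between hu.1
    have hc : c ∈ Ioo (0 : ℝ) 1 := ⟨hc0, hcu.trans hu.2⟩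
    have hDc := h.rightDerivative_neg hc
    have hfu := h.toReal_pos hu
    -- A lower bound for `F(a) - a` valid for every `a` in `(c,u)`, so `a` may then be taken within
    -- `η/4` of `u`. For `a < v < u + η/4` this gives `Fₙ(v) ≥ Fₙ(a) > a + 3η/4 > v + η/4`.
    set η := (φ u).toReal / -rightDerivative φ c with hη
    have hη0 : 0 < η := div_pos hfu (neg_pos.2 hDc)
    obtain ⟨a, ha, hca, hau⟩ := h.exists_mem_contPoints (a := max c (u - η / 4))
      (hc0.le.trans (le_max_left _ _)) (max_lt hcu (by linarith)) hu.2.le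
    have hca' := (le_max_left _ _).trans_lt hca
    have hηa : η ≤ tangentRoot φ a - a := by
      have h1 := h.monotoneOn_rightDerivative hc ha.1 hca'.le
      have h2 := h.rightDerivative_neg ha.1
      have h3 := h.strictAntiOn_toReal (Ioo_subset_Ioc_self ha.1) (Ioo_subset_Ioc_self hu) hau
      rw [tangentRoot, sub_sub_cancel_left, ← div_neg]
      exact div_le_div₀ (h.toReal_pos ha.1).le h3.le (by linarith) (by linarith)
    have hua := (le_max_right _ _).trans_lt hca
    refine ⟨Iio (min 1 (u + η / 4)) ∩ Ioi a, mem_nhdsWithin_of_mem_nhds (inter_mem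
      (Iio_mem_nhds (lt_min hu.2 (by linarith))) (Ioi_mem_nhds hau)), η / 4, by positivity, ?_⟩
    filter_upwards [(hb a ha).eventually (lt_mem_nhds (by linarith : a + 3 * η / 4 < _))] with n hn
    intro v hv
    have hv1 := lt_min_iff.1 hv.1.out
    have hv2 : a < v := hv.2
    have := (hs n).monotoneOn_tangentRoot ha.1 ⟨ha.1.1.trans hv2, hv1.1⟩ hv2.le
    linarith [hv1.2]

theorem tendsto_generator_of_tendsto_tangentRoot (h : IsNormalizedGenerator φ)
    (hs : ∀ n, IsNormalizedGenerator (φs n))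
    (hb : ∀ x ∈ contPoints φ, Tendsto (fun n => tangentRoot (φs n) x) atTop (𝓝 (tangentRoot φ x)))
    {x : ℝ} (hx : x ∈ Ioc (0 : ℝ) 1) : Tendsto (fun n => φs n x) atTop (𝓝 (φ x)) := by
  have hg := h.toIsGenerator
  have hgs := fun n => (hs n).toIsGenerator
  rcases hx.2.lt_or_eq with hx1 | rfl
  swap
  · simp only [h.map_one, (hs _).map_one]
    exact tendsto_const_nhds
  have hx' : x ∈ Ioo (0 : ℝ) 1 := ⟨hx.1, hx1⟩
  have hhalf : (1 / 2 : ℝ) ∈ Ioo (0 : ℝ) 1 := by norm_num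
  rw [← tendsto_toReal_generator_iff hg hgs hx]
  have hexp : ∀ ψ, IsNormalizedGenerator ψ →
      (ψ x).toReal = Real.exp (-∫ v in (1 / 2)..x, (tangentRoot ψ v - v)⁻¹) := fun ψ hψ => by
    rw [hψ.integral_inv_tangentRoot_sub hhalf hx', hψ.toReal_half, Real.log_one, neg_zero,
      sub_zero, neg_neg, Real.exp_log (hψ.toReal_pos hx')]
  simp only [hexp φ h, hexp _ (hs _)]
  refine (Real.continuous_exp.tendsto _).comp (Tendsto.neg ?_)
  have hsub : uIcc (1 / 2) x ⊆ Ioo 0 1 := ordConnected_Ioo.uIcc_subset hhalf hx'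
  obtain ⟨δ, hδ, hδn⟩ := exists_forall_le_tangentRoot_sub hg hgs hb isCompact_uIcc hsub
  refine intervalIntegral.tendsto_integral_filter_of_dominated_convergence
    (fun _ => δ⁻¹) (Eventually.of_forall fun n => ?_) ?_ intervalIntegrable_const ?_
  · exact ((hs n).intervalIntegrable_inv_tangentRoot_sub hhalf hx').def'.aestronglyMeasurable
  · filter_upwards [hδn] with n hn
    refine Eventually.of_forall fun v hv => ?_
    have := hn v (uIoc_subset_uIcc hv)
    rw [Real.norm_of_nonneg (inv_nonneg.2 (hδ.le.trans this))]
    exact inv_anti₀ hδ this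
  · filter_upwards [hg.ae_mem_contPoints] with v hv hvI
    have hv01 := hsub (uIoc_subset_uIcc hvI)
    exact ((hb v (hv hv01)).sub_const v).inv₀ (sub_pos.2 (h.lt_tangentRoot hv01)).ne'

/-- For positive `x`, `y`, comparing the copula with a level in `(0,1]` only involves generator
values on `(0,1]`; on the axes every copula vanishes. Hence values at `0` play no role. -/
theorem tendsto_archimedeanCopula_of_tendsto_generator (h : IsNormalizedGenerator φ)
    (hs : ∀ n, IsNormalizedGenerator (φs n))
    (hc : ∀ x ∈ Ioc (0 : ℝ) 1, Tendsto (fun n => φs n x) atTop (𝓝 (φ x)))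
    {x y : ℝ} (hx : x ∈ Icc (0 : ℝ) 1) (hy : y ∈ Icc (0 : ℝ) 1) :
    Tendsto (fun n => archimedeanCopula (φs n) x y) atTop (𝓝 (archimedeanCopula φ x y)) := by
  by_cases hxy : x = 0 ∨ y = 0
  · have hzero : ∀ ψ, IsNormalizedGenerator ψ → archimedeanCopula ψ x y = 0 := fun ψ hψ => by
      refine le_antisymm ((hψ.pseudoInverse_le_iff (by simp)).2 ?_) (hψ.pseudoInverse_mem _).1
      rcases hxy with rfl | rfl
      · exact le_self_add
      · exact le_add_self
    simp only [hzero φ h, hzero _ (hs _)]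
    exact tendsto_const_nhds
  rw [not_or] at hxy
  have hsum := (hc x ⟨lt_of_le_of_ne hx.1 (Ne.symm hxy.1), hx.2⟩).add
    (hc y ⟨lt_of_le_of_ne hy.1 (Ne.symm hxy.2), hy.2⟩)
  refine tendsto_order.2 ⟨fun a ha => ?_, fun a ha => ?_⟩
  · rcases lt_or_ge a 0 with ha0 | ha0
    · exact Eventually.of_forall fun n => ha0.trans_le ((hs n).pseudoInverse_mem _).1
    obtain ⟨b, hab, hb⟩ := exists_between ha
    have hb1 : b ∈ Ioc (0 : ℝ) 1 := ⟨ha0.trans_lt hab, hb.le.trans (h.pseudoInverse_mem _).2⟩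
    have := (h.lt_pseudoInverse_iff (Ioc_subset_Icc_self hb1)).1 hb
    filter_upwards [hsum.eventually_lt (hc b hb1) this] with n hn
    exact hab.trans (((hs n).lt_pseudoInverse_iff (Ioc_subset_Icc_self hb1)).2 hn)
  · rcases lt_or_ge 1 a with ha1 | ha1
    · exact Eventually.of_forall fun n => ((hs n).pseudoInverse_mem _).2.trans_lt ha1
    have ha01 : a ∈ Ioc (0 : ℝ) 1 := ⟨(h.pseudoInverse_mem _).1.trans_lt ha, ha1⟩
    have := (h.pseudoInverse_lt_iff ha01).1 ha
    filter_upwards [(hc a ha01).eventually_lt hsum this] with n hn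
    exact ((hs n).pseudoInverse_lt_iff ha01).2 hn

end Convergence

/-! ### From copulas to generators through dyadic levels. -/

theorem ENNReal.exists_nat_mul_inv_two_pow_between {a b : ℝ≥0∞} (hab : a < b) :
    ∃ k m : ℕ, a < (k + 1 : ℕ) * 2⁻¹ ^ m ∧ (k + 1 : ℕ) * 2⁻¹ ^ m < b := by
  obtain ⟨x, hax, hxb⟩ := ENNReal.lt_iff_exists_nnreal_btwn.1 hab
  obtain ⟨y, hxy, hyb⟩ := ENNReal.lt_iff_exists_nnreal_btwn.1 hxb
  have hxy : (0 : ℝ) < y - x := sub_pos.2 (by exact_mod_cast hxy)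
  obtain ⟨m, hm⟩ := exists_pow_lt_of_lt_one hxy (by norm_num : (2⁻¹ : ℝ) < 1)
  have he : (0 : ℝ) < 2⁻¹ ^ m := by positivity
  have hk1 := Nat.lt_floor_add_one ((x : ℝ) / 2⁻¹ ^ m)
  have hk2 := Nat.floor_le (a := (x : ℝ) / 2⁻¹ ^ m) (by positivity)
  rw [div_lt_iff₀ he] at hk1
  rw [le_div_iff₀ he] at hk2
  set k := ⌊(x : ℝ) / 2⁻¹ ^ m⌋₊
  have hcast : ((k + 1 : ℕ) : ℝ≥0∞) * 2⁻¹ ^ m = (((k + 1 : ℕ) * 2⁻¹ ^ m : ℝ≥0) : ℝ≥0∞) := by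
    push_cast
    rfl
  refine ⟨k, m, hax.trans ?_, lt_trans ?_ hyb⟩ <;> rw [hcast, ENNReal.coe_lt_coe] <;>
    rw [← NNReal.coe_lt_coe] <;> push_cast <;> linarith

/-- The level `r` is asymptotically separated: eventually `φs n z` lies on the same side of `r`
as `φ z` does. -/
def SeparatesLevel (φ : ℝ → ℝ≥0∞) (φs : ℕ → ℝ → ℝ≥0∞) (r : ℝ≥0∞) : Prop :=
  ∀ z ∈ Ioc (0 : ℝ) 1, (φ z < r → ∀ᶠ n in atTop, φs n z < r) ∧
    (r < φ z → ∀ᶠ n in atTop, r < φs n z)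

theorem IsNormalizedGenerator.exists_mem_Ioc_eq {φ : ℝ → ℝ≥0∞} (h : IsNormalizedGenerator φ)
    {s : ℝ≥0∞} (hs : s < φ 0) : ∃ x ∈ Ioc (0 : ℝ) 1, φ x = s := by
  obtain ⟨x, hx, rfl⟩ := h.exists_eq hs.le
  refine ⟨x, ⟨lt_of_le_of_ne hx.1 ?_, hx.2⟩, rfl⟩
  rintro rfl
  exact lt_irrefl _ hs

namespace SeparatesLevel

variable {φ : ℝ → ℝ≥0∞} {φs : ℕ → ℝ → ℝ≥0∞}

/-- All normalized generators cross the level `1` at the same point `1/2`. -/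
theorem one (h : IsNormalizedGenerator φ) (hs : ∀ n, IsNormalizedGenerator (φs n)) :
    SeparatesLevel φ φs 1 := by
  intro z hz
  have hz := Ioc_subset_Icc_self hz
  have hhalf : (1 / 2 : ℝ) ∈ Icc (0 : ℝ) 1 := by norm_num
  have hlt : ∀ ψ, IsNormalizedGenerator ψ → (ψ z < 1 ↔ 1 / 2 < z) := fun ψ hψ => by
    rw [← hψ.map_half, hψ.strictAntiOn.lt_iff_gt hz hhalf]
  have hgt : ∀ ψ, IsNormalizedGenerator ψ → (1 < ψ z ↔ z < 1 / 2) := fun ψ hψ => by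
    rw [← hψ.map_half, hψ.strictAntiOn.lt_iff_gt hhalf hz]
  simp only [hlt φ h, hgt φ h, hlt _ (hs _), hgt _ (hs _)]
  exact ⟨fun hz => Eventually.of_forall fun _ => hz, fun hz => Eventually.of_forall fun _ => hz⟩

/-- Uses the diagonal: a point `w` with `φ w` strictly between `2φ(z)` and `r` compares `C(z,z)`
with `w`, and both comparisons persist for large `n`. -/
theorem half {r : ℝ≥0∞} (h : IsNormalizedGenerator φ) (hs : ∀ n, IsNormalizedGenerator (φs n))
    (ha : ∀ x ∈ Icc (0 : ℝ) 1, ∀ y ∈ Icc (0 : ℝ) 1,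
      Tendsto (fun n => archimedeanCopula (φs n) x y) atTop (𝓝 (archimedeanCopula φ x y)))
    (hr : SeparatesLevel φ φs r) (hr0 : r < φ 0) : SeparatesLevel φ φs (r / 2) := by
  intro z hz
  have hz' := Ioc_subset_Icc_self hz
  have hlt : ∀ x : ℝ≥0∞, x < r / 2 ↔ x + x < r := fun x => by
    rw [ENNReal.lt_div_iff_mul_lt (Or.inl two_ne_zero) (Or.inl ENNReal.ofNat_ne_top), mul_two]
  have hgt : ∀ x : ℝ≥0∞, r / 2 < x ↔ r < x + x := fun x => by
    rw [ENNReal.div_lt_iff (Or.inl two_ne_zero) (Or.inl ENNReal.ofNat_ne_top), mul_two]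
  simp only [hlt, hgt]
  refine ⟨fun hzr => ?_, fun hzr => ?_⟩
  · obtain ⟨t, hzt, htr⟩ := exists_between hzr
    obtain ⟨w, hw, rfl⟩ := h.exists_mem_Ioc_eq (htr.trans hr0)
    filter_upwards [(hr w hw).1 htr, (ha z hz' z hz').eventually
      (lt_mem_nhds ((h.lt_pseudoInverse_iff (Ioc_subset_Icc_self hw)).2 hzt))] with n h1 h2
    exact (((hs n).lt_pseudoInverse_iff (Ioc_subset_Icc_self hw)).1 h2).trans h1
  -- The sum `φ z + φ z` may exceed `φ 0`; the intermediate level must still be a value of `φ` on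
  -- `(0,1]`.
  · obtain ⟨t, hrt, htz⟩ := exists_between (lt_min hzr hr0)
    obtain ⟨htz, ht0⟩ := lt_min_iff.1 htz
    obtain ⟨w, hw, rfl⟩ := h.exists_mem_Ioc_eq ht0
    filter_upwards [(hr w hw).2 hrt, (ha z hz' z hz').eventually
      (gt_mem_nhds ((h.pseudoInverse_lt_iff hw).2 htz))] with n h1 h2
    exact h1.trans (((hs n).pseudoInverse_lt_iff hw).1 h2)

/-- Points `x`, `y` at levels just below (or above) `r` and `s` reduce the comparison of `φ z` with
`r + s` to that of `C(x,y)` with `z`. -/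
theorem add {r s : ℝ≥0∞} (h : IsNormalizedGenerator φ)
    (hs : ∀ n, IsNormalizedGenerator (φs n))
    (ha : ∀ x ∈ Icc (0 : ℝ) 1, ∀ y ∈ Icc (0 : ℝ) 1,
      Tendsto (fun n => archimedeanCopula (φs n) x y) atTop (𝓝 (archimedeanCopula φ x y)))
    (hr : SeparatesLevel φ φs r) (ht : SeparatesLevel φ φs s) (hr0 : r ≠ 0) (hs0 : s ≠ 0)
    (hrs : r + s < φ 0) : SeparatesLevel φ φs (r + s) := by
  intro z hz
  have hz' := Ioc_subset_Icc_self hz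
  refine ⟨fun hzr => ?_, fun hzr => ?_⟩
  · obtain ⟨a, har, b, hbs, hab⟩ := ENNReal.exists_lt_add_of_lt_add hzr hr0 hs0
    obtain ⟨x, hx, rfl⟩ := h.exists_mem_Ioc_eq (har.trans (le_self_add.trans_lt hrs))
    obtain ⟨y, hy, rfl⟩ := h.exists_mem_Ioc_eq (hbs.trans (le_add_self.trans_lt hrs))
    filter_upwards [(hr x hx).1 har, (ht y hy).1 hbs,
      (ha x (Ioc_subset_Icc_self hx) y (Ioc_subset_Icc_self hy)).eventually
        (gt_mem_nhds ((h.pseudoInverse_lt_iff hz).2 hab))] with n h1 h2 h3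
    exact (((hs n).pseudoInverse_lt_iff hz).1 h3).trans (ENNReal.add_lt_add h1 h2)
  · obtain ⟨a, har, b, hbs, hab⟩ := ENNReal.exists_add_lt_of_add_lt hzr
    have hz0 : φ z < φ 0 := h.strictAntiOn (by simp) hz' hz.1
    obtain ⟨x, hx, rfl⟩ := h.exists_mem_Ioc_eq ((le_self_add.trans_lt hab).trans hz0)
    obtain ⟨y, hy, rfl⟩ := h.exists_mem_Ioc_eq ((le_add_self.trans_lt hab).trans hz0)
    filter_upwards [(hr x hx).2 har, (ht y hy).2 hbs,
      (ha x (Ioc_subset_Icc_self hx) y (Ioc_subset_Icc_self hy)).eventually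
        (lt_mem_nhds ((h.lt_pseudoInverse_iff hz').2 hab))] with n h1 h2 h3
    exact (ENNReal.add_lt_add h1 h2).trans (((hs n).lt_pseudoInverse_iff hz').1 h3)

theorem inv_two_pow (h : IsNormalizedGenerator φ) (hs : ∀ n, IsNormalizedGenerator (φs n))
    (ha : ∀ x ∈ Icc (0 : ℝ) 1, ∀ y ∈ Icc (0 : ℝ) 1,
      Tendsto (fun n => archimedeanCopula (φs n) x y) atTop (𝓝 (archimedeanCopula φ x y)))
    (m : ℕ) : SeparatesLevel φ φs (2⁻¹ ^ m) := by
  induction m with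
  | zero => simpa using one h hs
  | succ m ih =>
    have h1 : (1 : ℝ≥0∞) < φ 0 := by
      rw [← h.map_half]
      exact h.strictAntiOn (by simp) (by norm_num) (by norm_num)
    have h2 : (2⁻¹ : ℝ≥0∞) ^ m ≤ 1 := pow_le_one₀ zero_le (ENNReal.inv_le_one.2 one_le_two)
    exact pow_succ (2⁻¹ : ℝ≥0∞) m ▸ ih.half h hs ha (h2.trans_lt h1)

theorem nat_mul_inv_two_pow (h : IsNormalizedGenerator φ) (hs : ∀ n, IsNormalizedGenerator (φs n))
    (ha : ∀ x ∈ Icc (0 : ℝ) 1, ∀ y ∈ Icc (0 : ℝ) 1,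
      Tendsto (fun n => archimedeanCopula (φs n) x y) atTop (𝓝 (archimedeanCopula φ x y)))
    (k m : ℕ) (hk : (k + 1 : ℕ) * 2⁻¹ ^ m < φ 0) :
    SeparatesLevel φ φs ((k + 1 : ℕ) * 2⁻¹ ^ m) := by
  induction k with
  | zero => simpa using inv_two_pow h hs ha m
  | succ k ih =>
    have e : ((k + 1 + 1 : ℕ) : ℝ≥0∞) * 2⁻¹ ^ m = (k + 1 : ℕ) * 2⁻¹ ^ m + 2⁻¹ ^ m := by
      rw [Nat.cast_succ (k + 1), add_mul, one_mul]
    have hpow : (2⁻¹ : ℝ≥0∞) ^ m ≠ 0 := pow_ne_zero _ (by simp)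
    rw [e] at hk ⊢
    exact (ih (le_self_add.trans_lt hk)).add h hs ha (inv_two_pow h hs ha m)
      (mul_ne_zero (by simp) hpow) hpow hk

end SeparatesLevel

theorem tendsto_generator_of_tendsto_archimedeanCopula {φ : ℝ → ℝ≥0∞} {φs : ℕ → ℝ → ℝ≥0∞}
    (h : IsNormalizedGenerator φ) (hs : ∀ n, IsNormalizedGenerator (φs n))
    (ha : ∀ x ∈ Icc (0 : ℝ) 1, ∀ y ∈ Icc (0 : ℝ) 1,
      Tendsto (fun n => archimedeanCopula (φs n) x y) atTop (𝓝 (archimedeanCopula φ x y)))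
    {x : ℝ} (hx : x ∈ Ioc (0 : ℝ) 1) : Tendsto (fun n => φs n x) atTop (𝓝 (φ x)) := by
  have hx0 : φ x < φ 0 := h.strictAntiOn (by simp) (Ioc_subset_Icc_self hx) hx.1
  refine tendsto_order.2 ⟨fun a hax => ?_, fun a hax => ?_⟩
  · obtain ⟨k, m, h1, h2⟩ := ENNReal.exists_nat_mul_inv_two_pow_between hax
    exact ((SeparatesLevel.nat_mul_inv_two_pow h hs ha k m (h2.trans hx0) x hx).2 h2).mono
      fun n hn => h1.trans hn
  -- The minimum keeps the dyadic level below `φ 0`, where separation is known.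
  · obtain ⟨k, m, h1, h2⟩ := ENNReal.exists_nat_mul_inv_two_pow_between (lt_min hax hx0)
    obtain ⟨h2, h3⟩ := lt_min_iff.1 h2
    exact ((SeparatesLevel.nat_mul_inv_two_pow h hs ha k m h3 x hx).1 h1).mono
      fun n hn => hn.trans h2

theorem tfae_tendsto_archimedeanCopula {φ : ℝ → ℝ≥0∞} {φs : ℕ → ℝ → ℝ≥0∞}
    (h : IsNormalizedGenerator φ) (hs : ∀ n, IsNormalizedGenerator (φs n)) :
    List.TFAE [
      ∀ x ∈ Icc (0 : ℝ) 1, ∀ y ∈ Icc (0 : ℝ) 1,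
        Tendsto (fun n => archimedeanCopula (φs n) x y) atTop (𝓝 (archimedeanCopula φ x y)),
      ∀ x ∈ contPoints φ,
        Tendsto (fun n => kendallDistribution (archimedeanCopula (φs n)) x) atTop
          (𝓝 (kendallDistribution (archimedeanCopula φ) x)),
      ∀ x ∈ Ioc (0 : ℝ) 1, Tendsto (fun n => φs n x) atTop (𝓝 (φ x)),
      ∀ x ∈ contPoints φ,
        Tendsto (fun n => rightDerivative (φs n) x) atTop (𝓝 (rightDerivative φ x))] := by
  have hg := h.toIsGenerator
  have hgs := fun n => (hs n).toIsGenerator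
  have hkendall : (∀ x ∈ contPoints φ,
        Tendsto (fun n => kendallDistribution (archimedeanCopula (φs n)) x) atTop
          (𝓝 (kendallDistribution (archimedeanCopula φ) x))) ↔
      ∀ x ∈ contPoints φ,
        Tendsto (fun n => tangentRoot (φs n) x) atTop (𝓝 (tangentRoot φ x)) := by
    refine forall₂_congr fun x hx => ?_
    simp only [h.kendallDistribution_eq hx.1, (hs _).kendallDistribution_eq hx.1]
  tfae_have 1 → 3 := fun ha x hx => tendsto_generator_of_tendsto_archimedeanCopula h hs ha hx
  tfae_have 3 → 1 := fun hc x hx y hy =>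
    tendsto_archimedeanCopula_of_tendsto_generator h hs hc hx hy
  tfae_have 3 → 4 := fun hc x hx => tendsto_rightDerivative_of_tendsto_generator hg hgs hc hx
  tfae_have 4 → 3 := fun hd x hx => tendsto_generator_of_tendsto_rightDerivative hg hgs hd hx
  tfae_have 2 → 3 := fun hb x hx =>
    tendsto_generator_of_tendsto_tangentRoot h hs (hkendall.1 hb) hx
  tfae_have 3 → 2 := fun hc => hkendall.2 fun x hx => tendsto_const_nhds.sub
    (((tendsto_toReal_generator_iff hg hgs (Ioo_subset_Ioc_self hx.1)).2
      (hc x (Ioo_subset_Ioc_self hx.1))).div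
      (tendsto_rightDerivative_of_tendsto_generator hg hgs hc hx) (hg.rightDerivative_neg hx.1).ne)
  tfae_finish

/-! ### Failure of convergence at the origin. -/

noncomputable section

/-- The function equal to `g` on `(0,∞)` and to `v` at `0`. -/
def extendAtZero (g : ℝ → ℝ) (v : ℝ≥0∞) (x : ℝ) : ℝ≥0∞ :=
  if x ≤ 0 then v else ENNReal.ofReal (g x)

end

theorem extendAtZero_zero (g : ℝ → ℝ) (v : ℝ≥0∞) : extendAtZero g v 0 = v := if_pos le_rfl

theorem extendAtZero_of_pos (g : ℝ → ℝ) (v : ℝ≥0∞) {x : ℝ} (hx : 0 < x) :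
    extendAtZero g v x = ENNReal.ofReal (g x) := if_neg hx.not_ge

/-- Convexity at the endpoint `0` is the limit of the convexity inequality on `(0,1]` as one point
tends to `0`. -/
theorem isNormalizedGenerator_extendAtZero {g : ℝ → ℝ} {v : ℝ≥0∞}
    (hconv : ConvexOn ℝ (Ioc 0 1) g) (hanti : StrictAntiOn g (Ioc 0 1)) (h1 : g 1 = 0)
    (hhalf : g (1 / 2) = 1) (hv : Tendsto (fun x => ENNReal.ofReal (g x)) (𝓝[>] 0) (𝓝 v)) :
    IsNormalizedGenerator (extendAtZero g v) := by
  have hv' : Tendsto (extendAtZero g v) (𝓝[>] 0) (𝓝 v) := by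
    refine hv.congr' ?_
    filter_upwards [self_mem_nhdsWithin] with x hx
    exact (extendAtZero_of_pos g v hx).symm
  have hg0 : ∀ x ∈ Ioc (0 : ℝ) 1, 0 ≤ g x := fun x hx =>
    h1 ▸ hanti.antitoneOn hx (by simp) hx.2
  have hanti' : StrictAntiOn (extendAtZero g v) (Ioc 0 1) := fun x hx y hy hxy => by
    rw [extendAtZero_of_pos g v hx.1, extendAtZero_of_pos g v hy.1,
      ENNReal.ofReal_lt_ofReal_iff_of_nonneg (hg0 y hy)]
    exact hanti hx hy hxy
  have hpos : ∀ x ∈ Ioc (0 : ℝ) 1, ∀ y ∈ Ioc (0 : ℝ) 1, ∀ a b : ℝ≥0, a + b = 1 →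
      extendAtZero g v (a • x + b • y) ≤ a • extendAtZero g v x + b • extendAtZero g v y := by
    intro x hx y hy a b hab
    have hab' : (a : ℝ) + b = 1 := by exact_mod_cast hab
    have hxy := hconv.1 hx hy a.2 b.2 hab'
    have hle := hconv.2 hx hy a.2 b.2 hab'
    rw [extendAtZero_of_pos g v hx.1, extendAtZero_of_pos g v hy.1]
    refine (extendAtZero_of_pos g v hxy.1).trans_le ((ENNReal.ofReal_le_ofReal hle).trans_eq ?_)
    rw [ENNReal.ofReal_add (smul_nonneg a.2 (hg0 x hx)) (smul_nonneg b.2 (hg0 y hy)), smul_eq_mul,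
      smul_eq_mul, ENNReal.ofReal_mul a.2, ENNReal.ofReal_mul b.2]
    simp [ENNReal.smul_def]
  have hzero : ∀ y ∈ Ioc (0 : ℝ) 1, ∀ a b : ℝ≥0, a + b = 1 →
      extendAtZero g v (b • y) ≤ a • v + b • extendAtZero g v y := by
    intro y hy a b hab
    have hab' : (a : ℝ) + b = 1 := by exact_mod_cast hab
    rcases eq_or_ne b 0 with rfl | hb
    · rw [add_zero] at hab
      simp [hab, extendAtZero_zero]
    rcases eq_or_ne a 0 with rfl | ha
    · rw [zero_add] at hab
      simp [hab]
    have ha0 : (0 : ℝ) < a := by positivity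
    have hb0 : (0 : ℝ) < b := by positivity
    have hby : (b : ℝ) * y ∈ Ioo (0 : ℝ) 1 :=
      ⟨mul_pos hb0 hy.1, by nlinarith [hy.2]⟩
    have hgc : ContinuousAt g (b * y) := by
      have := hconv.continuousOn_interior
      rw [interior_Ioc] at this
      exact this.continuousAt (Ioo_mem_nhds hby.1 hby.2)
    have hec : ContinuousAt (extendAtZero g v) (b * y) := by
      refine (ENNReal.continuous_ofReal.continuousAt.comp hgc).congr ?_
      filter_upwards [Ioi_mem_nhds hby.1] with x hx
      exact (extendAtZero_of_pos g v hx).symm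
    have hlhs : Tendsto (fun x : ℝ => extendAtZero g v (a • x + b • y)) (𝓝[>] 0)
        (𝓝 (extendAtZero g v (b • y))) := by
      refine hec.tendsto.comp (Tendsto.mono_left ?_ nhdsWithin_le_nhds)
      have : Continuous fun x : ℝ => (a : ℝ) * x + b * y := by fun_prop
      simpa [NNReal.smul_def] using this.tendsto 0
    have hrhs : Tendsto (fun x : ℝ => a • extendAtZero g v x + b • extendAtZero g v y) (𝓝[>] 0)
        (𝓝 (a • v + b • extendAtZero g v y)) :=
      ((ENNReal.continuous_const_mul ENNReal.coe_ne_top).tendsto v |>.comp hv').add_const _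
    refine le_of_tendsto_of_tendsto hlhs hrhs ?_
    filter_upwards [Ioo_mem_nhdsGT zero_lt_one] with x hx
    exact hpos x (Ioo_subset_Ioc_self hx) y hy a b hab
  refine ⟨⟨⟨convex_Icc 0 1, ?_⟩, ?_, ?_⟩, ?_, ?_⟩
  · intro x hx y hy a b _ _ hab
    rcases hx.1.eq_or_lt with rfl | hx0
    · rcases hy.1.eq_or_lt with rfl | hy0
      · rw [smul_zero, smul_zero, add_zero, ← add_smul, hab, one_smul]
      · simpa [extendAtZero_zero] using hzero y ⟨hy0, hy.2⟩ a b hab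
    · rcases hy.1.eq_or_lt with rfl | hy0
      · rw [add_comm] at hab
        simpa [extendAtZero_zero, add_comm] using hzero x ⟨hx0, hx.2⟩ b a hab
      · exact hpos x ⟨hx0, hx.2⟩ y ⟨hy0, hy.2⟩ a b hab
  · intro x hx y hy hxy
    have hy0 : 0 < y := hx.1.trans_lt hxy
    rcases hx.1.eq_or_lt with rfl | hx0
    -- Limits preserve only weak inequalities; the intermediate point `y / 2` supplies strictness.
    · have hy2 : y / 2 ∈ Ioc (0 : ℝ) 1 := ⟨by linarith, by linarith [hy.2]⟩
      refine (hanti' hy2 ⟨hy0, hy.2⟩ (by linarith)).trans_le ?_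
      rw [extendAtZero_zero]
      refine ge_of_tendsto hv' ?_
      filter_upwards [Ioo_mem_nhdsGT hy2.1] with x hx
      exact hanti'.antitoneOn ⟨hx.1, hx.2.le.trans hy2.2⟩ hy2 hx.2.le
    · exact hanti' ⟨hx0, hx.2⟩ ⟨hy0, hy.2⟩ hxy
  · rw [extendAtZero_of_pos g v one_pos, h1, ENNReal.ofReal_zero]
  · rw [← continuousWithinAt_Ioi_iff_Ici, ContinuousWithinAt, extendAtZero_zero]
    exact hv'
  · rw [extendAtZero_of_pos g v (by norm_num), hhalf, ENNReal.ofReal_one]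

theorem strictAntiOn_mixed {c : ℝ} (hc0 : 0 < c) (hc1 : c ≤ 1) :
    StrictAntiOn (fun x : ℝ => c * (2 * (1 - x)) + (1 - c) * (x⁻¹ - 1)) (Ioc 0 1) := by
  intro x hx y hy hxy
  have h1 : y⁻¹ ≤ x⁻¹ := inv_anti₀ hx.1 hxy.le
  have h2 : (1 - c) * (y⁻¹ - 1) ≤ (1 - c) * (x⁻¹ - 1) :=
    mul_le_mul_of_nonneg_left (by linarith) (by linarith)
  have h3 : c * (2 * (1 - y)) < c * (2 * (1 - x)) := mul_lt_mul_of_pos_left (by linarith) hc0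
  exact add_lt_add_of_lt_of_le h3 h2

theorem convexOn_mixed {c : ℝ} (hc1 : c ≤ 1) :
    ConvexOn ℝ (Ioc 0 1) (fun x : ℝ => c * (2 * (1 - x)) + (1 - c) * (x⁻¹ - 1)) := by
  have h1 : ConvexOn ℝ (Ioc (0 : ℝ) 1) fun x : ℝ => c * (2 * (1 - x)) :=
    ⟨convex_Ioc 0 1, fun x _ y _ a b _ _ hab => le_of_eq (by
      simp only [smul_eq_mul]
      linear_combination -2 * c * hab)⟩
  have h2 : ConvexOn ℝ (Ioc (0 : ℝ) 1) fun x : ℝ => x⁻¹ + (-1) := by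
    have := convexOn_zpow (𝕜 := ℝ) (-1)
    simp only [zpow_neg_one] at this
    exact (this.subset Ioc_subset_Ioi_self (convex_Ioc 0 1)).add_const _
  exact h1.add (h2.smul (sub_nonneg.2 hc1))

/-- Kept in the form of the mixed family at `c = 1`, so that convergence on `(0,1]` is continuity in
`c`. -/
theorem isNormalizedGenerator_linear :
    IsNormalizedGenerator (extendAtZero
      (fun x => 1 * (2 * (1 - x)) + (1 - 1) * (x⁻¹ - 1)) (ENNReal.ofReal 2)) := by
  refine isNormalizedGenerator_extendAtZero (convexOn_mixed le_rfl)
    (strictAntiOn_mixed one_pos le_rfl) (by norm_num) (by norm_num) ?_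
  have : Continuous fun x : ℝ => ENNReal.ofReal (2 * (1 - x)) :=
    ENNReal.continuous_ofReal.comp (by fun_prop)
  simpa using (this.tendsto 0).mono_left nhdsWithin_le_nhds

theorem isNormalizedGenerator_mixed {c : ℝ} (hc0 : 0 < c) (hc1 : c < 1) :
    IsNormalizedGenerator (extendAtZero
      (fun x => c * (2 * (1 - x)) + (1 - c) * (x⁻¹ - 1)) ⊤) := by
  refine isNormalizedGenerator_extendAtZero (convexOn_mixed hc1.le)
    (strictAntiOn_mixed hc0 hc1.le) (by norm_num) (by norm_num) ?_
  refine ENNReal.tendsto_ofReal_nhds_top.2 (tendsto_atTop_mono' _ ?_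
    ((tendsto_atTop_add_const_right _ (-1) (tendsto_inv_nhdsGT_zero (𝕜 := ℝ))).const_mul_atTop
      (sub_pos.2 hc1)))
  filter_upwards [Ioo_mem_nhdsGT zero_lt_one] with x hx
  have : 0 ≤ c * (2 * (1 - x)) := by
    have := hx.2
    exact mul_nonneg hc0.le (by linarith)
  linarith

theorem exists_tendsto_archimedeanCopula_not_tendsto_zero :
    ∃ (φ : ℝ → ℝ≥0∞) (φs : ℕ → ℝ → ℝ≥0∞),
      IsNormalizedGenerator φ ∧ (∀ n, IsNormalizedGenerator (φs n)) ∧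
      (∀ x ∈ Icc (0 : ℝ) 1, ∀ y ∈ Icc (0 : ℝ) 1,
        Tendsto (fun n => archimedeanCopula (φs n) x y) atTop (𝓝 (archimedeanCopula φ x y))) ∧
      ¬ Tendsto (fun n => φs n 0) atTop (𝓝 (φ 0)) := by
  -- The factor `1 / 2` keeps the weight positive at `n = 0`.
  have hc0 : ∀ n : ℕ, (0 : ℝ) < 1 - 1 / 2 * (1 / (n + 1)) := fun n => by
    have : (1 : ℝ) / (n + 1) ≤ 1 := div_le_one_of_le₀ (by simp) (by positivity)
    linarith
  have hc1 : ∀ n : ℕ, (1 : ℝ) - 1 / 2 * (1 / (n + 1)) < 1 := fun n => by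
    have : (0 : ℝ) < 1 / (n + 1) := by positivity
    linarith
  have hc : Tendsto (fun n : ℕ => (1 : ℝ) - 1 / 2 * (1 / (n + 1))) atTop (𝓝 1) := by
    have := ((tendsto_one_div_add_atTop_nhds_zero_nat (𝕜 := ℝ)).const_mul (1 / 2)).const_sub 1
    rwa [mul_zero, sub_zero] at this
  have hφ := isNormalizedGenerator_linear
  have hφs := fun n => isNormalizedGenerator_mixed (hc0 n) (hc1 n)
  refine ⟨_, _, hφ, hφs, fun x hx y hy =>
    tendsto_archimedeanCopula_of_tendsto_generator hφ hφs (fun x hx => ?_) hx hy, ?_⟩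
  · simp only [extendAtZero_of_pos _ _ hx.1]
    exact (ENNReal.continuous_ofReal.tendsto _).comp
      ((hc.mul_const _).add ((hc.const_sub 1).mul_const _))
  · simp only [extendAtZero_zero]
    intro h
    exact ENNReal.ofReal_ne_top (tendsto_nhds_unique h tendsto_const_nhds)

theorem mainTheorem4 :
    (∀ (φ : ℝ → ℝ≥0∞) (φs : ℕ → ℝ → ℝ≥0∞),
      IsNormalizedGenerator φ → (∀ n, IsNormalizedGenerator (φs n)) →
      List.TFAE [
        ∀ x ∈ Icc (0 : ℝ) 1, ∀ y ∈ Icc (0 : ℝ) 1,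
          Tendsto (fun n => archimedeanCopula (φs n) x y) atTop (𝓝 (archimedeanCopula φ x y)),
        ∀ x ∈ contPoints φ,
          Tendsto (fun n => kendallDistribution (archimedeanCopula (φs n)) x) atTop
            (𝓝 (kendallDistribution (archimedeanCopula φ) x)),
        ∀ x ∈ Ioc (0 : ℝ) 1, Tendsto (fun n => φs n x) atTop (𝓝 (φ x)),
        ∀ x ∈ contPoints φ,
          Tendsto (fun n => rightDerivative (φs n) x) atTop (𝓝 (rightDerivative φ x))]) ∧
    (∃ (φ : ℝ → ℝ≥0∞) (φs : ℕ → ℝ → ℝ≥0∞),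
      IsNormalizedGenerator φ ∧ (∀ n, IsNormalizedGenerator (φs n)) ∧
      (∀ x ∈ Icc (0 : ℝ) 1, ∀ y ∈ Icc (0 : ℝ) 1,
        Tendsto (fun n => archimedeanCopula (φs n) x y) atTop (𝓝 (archimedeanCopula φ x y))) ∧
      ¬ Tendsto (fun n => φs n 0) atTop (𝓝 (φ 0))) :=
  ⟨fun _ _ h hs => tfae_tendsto_archimedeanCopula h hs,
    exists_tendsto_archimedeanCopula_not_tendsto_zero⟩
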